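/- Let $(M,g)$ be a smooth four-dimensional Lorentzian manifold (signature $-+++$), let $U\subseteq M$ be open (possibly $U=M$), and let $(\ell,n,m^{(2)},m^{(3)})$ be a smooth null frame on $U$, i.e. $\ell^a\ell_a=n^an_a=0$, $\ell^an_a=1$, $m^{(i)a}m^{(j)}_a=\delta_{ij}$, and $\ell$, $n$ are orthogonal to $m^{(2)},m^{(3)}$. Let $\gamma',\alpha',\beta',\Lambda$ be real constants with $\alpha'\neq0$ or $\gamma'+8\beta'\Lambda\neq0$. Suppose that on $U$ the metric satisfies the vacuum field equations of quadratic gravity $$\gamma'\left(R_{ab}-\tfrac12Rg_{ab}+\Lambda g_{ab}\right)-4\alpha'B_{ab}+2\beta'\left(R_{ab}-\tfrac14Rg_{ab}+g_{ab}\Box-\nabla_b\nabla_a\right)R=0,\qquad B_{ab}=\left(\nabla^c\nabla^d+\tfrac12R^{cd}\right)C_{acbd},$$ where $C_{abcd}$ is the Weyl tensor, and that there are functions $\psi'_2,\psi'_3,\omega'$ on $U$ such that, with summation over $i=2,3$, $$R_{ab}=\Lambda g_{ab}+\psi'_i\left(\ell_am^{(i)}_b+m^{(i)}_a\ell_b\right)+\omega'\ell_a\ell_b,\qquad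 \psi'_i\psi'_i\neq0\ \text{ everywhere on } U.$$ Suppose moreover that the Weyl tensor is of Petrov type II or more special, aligned with $\ell$: all its components of positive boost weight in the given frame vanish on $U$ (an index contracted with $\ell$, $n$, $m^{(i)}$ contributes boost weight $+1$, $-1$, $0$, respectively). Then $\ell$ is geodetic, i.e. $\ell^b\nabla_b\ell_a$ is proportional to $\ell_a$ on $U$, and the spacetime is Kundt: with $\rho_{ij}=\ell_{a;b}m^{(i)a}m^{(j)b}$, the expansion $\tfrac12\rho_{kk}$, the shear $\rho_{(ij)}-\tfrac12\rho_{kk}\delta_{ij}$ and the twist $\rho_{[ij]}$ of $\ell$ vanish on $U$. -/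

import Mathlib

open scoped Manifold ContDiff Bundle

noncomputable section

namespace QuadraticGravity

/-! ## Tensor calculus in local coordinates

A metric in local coordinates is a matrix-valued function `G` of the coordinates. -/

/-- The coordinate space `ℝ⁴`. -/
abbrev E4 : Type := EuclideanSpace ℝ (Fin 4)

/-- Components of a covariant tensor field of rank `k` in local coordinates. -/
abbrev CoordTensor (k : ℕ) : Type := (Fin k → Fin 4) → E4 → ℝ

/-- The partial derivative `∂ᵢ f`. -/
def pderiv (i : Fin 4) (f : E4 → ℝ) (y : E4) : ℝ :=
  fderiv ℝ f y (EuclideanSpace.single i 1)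

/-- Christoffel symbols `Γᵃ_{bc} = ½ gᵃᵈ (∂_b g_{dc} + ∂_c g_{db} - ∂_d g_{bc})`. -/
def christoffel (G : E4 → Matrix (Fin 4) (Fin 4) ℝ) (a b c : Fin 4) (y : E4) : ℝ :=
  1 / 2 * ∑ d, (G y)⁻¹ a d *
    (pderiv b (fun z => G z d c) y + pderiv c (fun z => G z d b) y
      - pderiv d (fun z => G z b c) y)

/-- Levi-Civita covariant derivative of a covariant tensor field; the index of differentiation
comes first: `(∇T)_{c a₁…a_k} = ∇_c T_{a₁…a_k} = ∂_c T_{a₁…a_k} - ∑ₛ Γᵈ_{c aₛ} T_{a₁…d…a_k}`. -/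
def covDeriv (G : E4 → Matrix (Fin 4) (Fin 4) ℝ) {k : ℕ} (T : CoordTensor k) :
    CoordTensor (k + 1) := fun i y =>
  pderiv (i 0) (T (Fin.tail i)) y
    - ∑ s : Fin k, ∑ d : Fin 4, christoffel G d (i 0) (Fin.tail i s) y *
        T (Function.update (Fin.tail i) s d) y

/-- Curvature tensor
`Rᵃ_{bcd} = ∂_c Γᵃ_{db} - ∂_d Γᵃ_{cb} + Γᵃ_{ce} Γᵉ_{db} - Γᵃ_{de} Γᵉ_{cb}`. -/
def riemannUp (G : E4 → Matrix (Fin 4) (Fin 4) ℝ) (a b c d : Fin 4) (y : E4) : ℝ :=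
  pderiv c (christoffel G a d b) y - pderiv d (christoffel G a c b) y
    + ∑ e, (christoffel G a c e y * christoffel G e d b y
        - christoffel G a d e y * christoffel G e c b y)

/-- Fully covariant curvature tensor `R_{abcd} = g_{ae} Rᵉ_{bcd}`. -/
def riemann (G : E4 → Matrix (Fin 4) (Fin 4) ℝ) (a b c d : Fin 4) (y : E4) : ℝ :=
  ∑ e, G y a e * riemannUp G e b c d y

/-- Ricci tensor `R_{ab} = Rᶜ_{acb}`. -/
def ricci (G : E4 → Matrix (Fin 4) (Fin 4) ℝ) (a b : Fin 4) (y : E4) : ℝ :=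
  ∑ c, riemannUp G c a c b y

/-- Ricci scalar `R = gᵃᵇ R_{ab}`. -/
def scalarCurv (G : E4 → Matrix (Fin 4) (Fin 4) ℝ) (y : E4) : ℝ :=
  ∑ a, ∑ b, (G y)⁻¹ a b * ricci G a b y

/-- Ricci tensor with raised indices, `Rᵃᵇ = gᵃᶜ gᵇᵈ R_{cd}`. -/
def ricciUp (G : E4 → Matrix (Fin 4) (Fin 4) ℝ) (a b : Fin 4) (y : E4) : ℝ :=
  ∑ c, ∑ d, (G y)⁻¹ a c * (G y)⁻¹ b d * ricci G c d y

/-- Weyl tensor in dimension four. -/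
def weyl (G : E4 → Matrix (Fin 4) (Fin 4) ℝ) (a b c d : Fin 4) (y : E4) : ℝ :=
  riemann G a b c d y
    - 1 / 2 * (G y a c * ricci G b d y - G y a d * ricci G b c y
        - G y b c * ricci G a d y + G y b d * ricci G a c y)
    + scalarCurv G y / 6 * (G y a c * G y b d - G y a d * G y b c)

/-- The Weyl tensor as a tensor field of rank four. -/
def weylTensor (G : E4 → Matrix (Fin 4) (Fin 4) ℝ) : CoordTensor 4 :=
  fun i => weyl G (i 0) (i 1) (i 2) (i 3)

/-- Bach tensor `B_{ab} = (∇ᶜ∇ᵈ + ½ Rᶜᵈ) C_{acbd}`. -/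
def bach (G : E4 → Matrix (Fin 4) (Fin 4) ℝ) (a b : Fin 4) (y : E4) : ℝ :=
  (∑ c, ∑ d, ∑ e, ∑ f, (G y)⁻¹ c e * (G y)⁻¹ d f *
      covDeriv G (covDeriv G (weylTensor G)) ![e, f, a, c, b, d] y)
    + 1 / 2 * ∑ c, ∑ d, ricciUp G c d y * weyl G a c b d y

/-- Second covariant derivatives of the Ricci scalar, `∇_a ∇_b R`. -/
def hessScalar (G : E4 → Matrix (Fin 4) (Fin 4) ℝ) (a b : Fin 4) (y : E4) : ℝ :=
  covDeriv G (covDeriv G (k := 0) (fun _ => scalarCurv G)) ![a, b] y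

/-- `□R = gᵃᵇ ∇_a ∇_b R`. -/
def boxScalar (G : E4 → Matrix (Fin 4) (Fin 4) ℝ) (y : E4) : ℝ :=
  ∑ a, ∑ b, (G y)⁻¹ a b * hessScalar G a b y

/-- The `ab` component of the left-hand side of the vacuum field equations of quadratic gravity,
`γ' (R_{ab} - ½ R g_{ab} + Λ g_{ab}) - 4 α' B_{ab}
  + 2 β' (R_{ab} - ¼ R g_{ab} + g_{ab} □ - ∇_b ∇_a) R`. -/
def fieldTensor (γ' α' β' Λ : ℝ) (G : E4 → Matrix (Fin 4) (Fin 4) ℝ) (a b : Fin 4) (y : E4) : ℝ :=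
  γ' * (ricci G a b y - 1 / 2 * scalarCurv G y * G y a b + Λ * G y a b)
    - 4 * α' * bach G a b y
    + 2 * β' * ((ricci G a b y - 1 / 4 * scalarCurv G y * G y a b) * scalarCurv G y
        + G y a b * boxScalar G y - hessScalar G b a y)

/-! ## Spacetimes -/

variable {M : Type*} [TopologicalSpace M] [ChartedSpace E4 M]

/-- The tangent space of the four-manifold `M` at `x`. -/
abbrev Tan (x : M) : Type := TangentSpace (𝓡 4) x

/-- A smooth Lorentzian metric, of signature `(-,+,+,+)`, on a smooth four-manifold. -/
structure LorentzMetric (M : Type*) [TopologicalSpace M] [ChartedSpace E4 M]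
    [IsManifold (𝓡 4) ∞ M] where
  /-- The inner product on each tangent space. -/
  inner : ∀ x : M, Tan x →L[ℝ] Tan x →L[ℝ] ℝ
  symm : ∀ (x : M) (v w : Tan x), inner x v w = inner x w v
  lorentzian : ∀ x : M, ∃ b : Module.Basis (Fin 4) ℝ (Tan x), ∀ i j : Fin 4,
    inner x (b i) (b j) = if i = j then (if i = 0 then -1 else 1) else 0
  contMDiff : ContMDiff (𝓡 4) ((𝓡 4).prod 𝓘(ℝ, E4 →L[ℝ] E4 →L[ℝ] ℝ)) ∞
    (fun x => Bundle.TotalSpace.mk' (E4 →L[ℝ] E4 →L[ℝ] ℝ)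
      (E := fun x : M => Tan x →L[ℝ] Tan x →L[ℝ] ℝ) x (inner x))

/-- Components `Xⁱ` of a vector field in the chart `e`. -/
def vecInChart (X : ∀ x : M, Tan x) (e : OpenPartialHomeomorph M E4) (i : Fin 4) (y : E4) : ℝ :=
  let v : E4 := mfderiv (𝓡 4) 𝓘(ℝ, E4) e (e.symm y) (X (e.symm y))
  v i

variable [IsManifold (𝓡 4) ∞ M]

/-- Components `g(∂ᵢ, ∂ⱼ)` of the metric in the chart `e`. -/
def LorentzMetric.inChart (g : LorentzMetric M) (e : OpenPartialHomeomorph M E4) :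
    E4 → Matrix (Fin 4) (Fin 4) ℝ := fun y =>
  Matrix.of fun i j => g.inner (e.symm y)
    (mfderiv 𝓘(ℝ, E4) (𝓡 4) e.symm y (EuclideanSpace.single i (1 : ℝ) : E4))
    (mfderiv 𝓘(ℝ, E4) (𝓡 4) e.symm y (EuclideanSpace.single j (1 : ℝ) : E4))

/-- Components `Xᵢ = gᵢⱼ Xʲ` of the metrically equivalent covector field in the chart `e`. -/
def LorentzMetric.lowerInChart (g : LorentzMetric M) (X : ∀ x : M, Tan x)
    (e : OpenPartialHomeomorph M E4) (i : Fin 4) (y : E4) : ℝ :=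
  ∑ j, g.inChart e y i j * vecInChart X e j y

/-- Components `∇_b X_a` of the covariant derivative of a vector field in the chart `e`. -/
def LorentzMetric.covDerivInChart (g : LorentzMetric M) (X : ∀ x : M, Tan x)
    (e : OpenPartialHomeomorph M E4) (b a : Fin 4) (y : E4) : ℝ :=
  covDeriv (g.inChart e) (k := 1) (fun i => g.lowerInChart X e (i 0)) ![b, a] y

/-- The statement `P` about coordinate components holds at all points of `U`, in all coordinate
systems of the atlas. -/
def ForAllCoords (U : Set M) (P : OpenPartialHomeomorph M E4 → E4 → Prop) : Prop :=
  ∀ e ∈ atlas E4 M, ∀ y ∈ e.target, e.symm y ∈ U → P e y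

/-- The metric satisfies the vacuum field equations of quadratic gravity on `U`. -/
def IsVacuumSolutionOn (g : LorentzMetric M) (U : Set M) (γ' α' β' Λ : ℝ) : Prop :=
  ForAllCoords U fun e y => ∀ a b, fieldTensor γ' α' β' Λ (g.inChart e) a b y = 0

/-! ## Null frames -/

/-- A smooth null frame `(ℓ, n, m⁽²⁾, m⁽³⁾)` on `U`. -/
structure NullFrameOn (g : LorentzMetric M) (U : Set M) where
  /-- The null vector field `ℓ`. -/
  l : ∀ x : M, Tan x
  /-- The null vector field `n`. -/
  n : ∀ x : M, Tan x
  /-- The spacelike vector fields `m⁽²⁾`, `m⁽³⁾`. -/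
  m : Fin 2 → ∀ x : M, Tan x
  smooth_l : ContMDiffOn (𝓡 4) (𝓡 4).tangent ∞ (fun x => (⟨x, l x⟩ : TangentBundle (𝓡 4) M)) U
  smooth_n : ContMDiffOn (𝓡 4) (𝓡 4).tangent ∞ (fun x => (⟨x, n x⟩ : TangentBundle (𝓡 4) M)) U
  smooth_m : ∀ i,
    ContMDiffOn (𝓡 4) (𝓡 4).tangent ∞ (fun x => (⟨x, m i x⟩ : TangentBundle (𝓡 4) M)) U
  l_l : ∀ x ∈ U, g.inner x (l x) (l x) = 0
  n_n : ∀ x ∈ U, g.inner x (n x) (n x) = 0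
  l_n : ∀ x ∈ U, g.inner x (l x) (n x) = 1
  l_m : ∀ i, ∀ x ∈ U, g.inner x (l x) (m i x) = 0
  n_m : ∀ i, ∀ x ∈ U, g.inner x (n x) (m i x) = 0
  m_m : ∀ i j, ∀ x ∈ U, g.inner x (m i x) (m j x) = if i = j then 1 else 0

/-- The boost weight contributed by a frame component along `ℓ, n, m⁽²⁾, m⁽³⁾`, respectively:
under `ℓ ↦ c ℓ`, `n ↦ c⁻¹ n`, the frame component is multiplied by `c` to this power. -/
def boostWeight : Fin 4 → ℤ := ![1, -1, 0, 0]

namespace NullFrameOn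

variable {g : LorentzMetric M} {U : Set M} (F : NullFrameOn g U)

/-- The frame vectors in the order `ℓ, n, m⁽²⁾, m⁽³⁾`. -/
def vec : Fin 4 → ∀ x : M, Tan x := ![F.l, F.n, F.m 0, F.m 1]

/-- Frame components of the Weyl tensor, `C_{abcd} v_Aᵃ v_Bᵇ v_Cᶜ v_Dᵈ`, computed in the chart
`e`. -/
def weylComponent (A B C D : Fin 4) (e : OpenPartialHomeomorph M E4) (y : E4) : ℝ :=
  ∑ a, ∑ b, ∑ c, ∑ d, weyl (g.inChart e) a b c d y *
    vecInChart (F.vec A) e a y * vecInChart (F.vec B) e b y *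
    vecInChart (F.vec C) e c y * vecInChart (F.vec D) e d y

/-- The Weyl tensor has boost order at most `0` with respect to `ℓ`, i.e. all its frame components
of positive boost weight vanish on `U`: it is of Petrov type II or more special, aligned
with `ℓ`. -/
def IsAlignedPetrovII : Prop :=
  ∀ A B C D : Fin 4, 0 < boostWeight A + boostWeight B + boostWeight C + boostWeight D →
    ForAllCoords U fun e y => F.weylComponent A B C D e y = 0

/-- On `U` the Ricci tensor is `Λ g_{ab} + ψ'_i (ℓ_a m⁽ⁱ⁾_b + m⁽ⁱ⁾_a ℓ_b) + ω' ℓ_a ℓ_b`, where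
`ψ'_i`, `ω'` are functions and `ψ'_i ψ'_i` vanishes nowhere: the traceless Ricci tensor is of
type III. -/
def IsRicciTypeIII (Λ : ℝ) : Prop :=
  ∃ (ψ' : Fin 2 → M → ℝ) (ω' : M → ℝ), (∀ x ∈ U, ∑ i, ψ' i x * ψ' i x ≠ 0) ∧
    ForAllCoords U fun e y => ∀ a b,
      ricci (g.inChart e) a b y = Λ * g.inChart e y a b
        + ∑ i, ψ' i (e.symm y) *
            (g.lowerInChart F.l e a y * g.lowerInChart (F.m i) e b y
              + g.lowerInChart (F.m i) e a y * g.lowerInChart F.l e b y)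
        + ω' (e.symm y) * g.lowerInChart F.l e a y * g.lowerInChart F.l e b y

/-- The integral curves of `ℓ` are (not necessarily affinely parametrized) geodesics:
`ℓᵇ ∇_b ℓ_a` is proportional to `ℓ_a`. -/
def IsGeodetic : Prop :=
  ForAllCoords U fun e y => ∃ f : ℝ, ∀ a,
    ∑ b, vecInChart F.l e b y * g.covDerivInChart F.l e b a y = f * g.lowerInChart F.l e a y

/-- The optical matrix `ρ_{ij} = ℓ_{a;b} m⁽ⁱ⁾ᵃ m⁽ʲ⁾ᵇ`, computed in the chart `e`. -/
def opticalMatrix (e : OpenPartialHomeomorph M E4) (y : E4) : Matrix (Fin 2) (Fin 2) ℝ :=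
  Matrix.of fun i j => ∑ a, ∑ b, g.covDerivInChart F.l e b a y *
    vecInChart (F.m i) e a y * vecInChart (F.m j) e b y

/-- Expansion `θ = ½ ρ_{kk}`. -/
def expansion (e : OpenPartialHomeomorph M E4) (y : E4) : ℝ :=
  1 / 2 * (F.opticalMatrix e y).trace

/-- Shear matrix `σ_{ij} = ρ_{(ij)} - ½ ρ_{kk} δ_{ij}`. -/
def shearMatrix (e : OpenPartialHomeomorph M E4) (y : E4) : Matrix (Fin 2) (Fin 2) ℝ :=
  (1 / 2 : ℝ) • (F.opticalMatrix e y + (F.opticalMatrix e y).transpose) - F.expansion e y • 1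

/-- Twist matrix `A_{ij} = ρ_{[ij]}`. -/
def twistMatrix (e : OpenPartialHomeomorph M E4) (y : E4) : Matrix (Fin 2) (Fin 2) ℝ :=
  (1 / 2 : ℝ) • (F.opticalMatrix e y - (F.opticalMatrix e y).transpose)

/-- The null congruence generated by `ℓ` on `U` is geodetic, nonexpanding, shearfree and
twistfree, so that `U` is a Kundt spacetime. -/
structure IsKundt : Prop where
  geodetic : F.IsGeodetic
  nonexpanding : ForAllCoords U fun e y => F.expansion e y = 0
  shearfree : ForAllCoords U fun e y => F.shearMatrix e y = 0
  twistfree : ForAllCoords U fun e y => F.twistMatrix e y = 0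

end NullFrameOn

end QuadraticGravity

end

/-!
The statement is local, so it suffices to work in one coordinate domain `V`. There the argument is
pure tensor algebra: the smooth functions on `V` form an `ℝ`-algebra `A` with four commuting
derivations, and the metric together with the null frame is a `FrameMetric A`. Covariant tensors are
iterated `A`-linear maps on `Vec A`, the Gram relations of the frame make the metric invertible
(`mul_completeness_eq_one`), and Levi-Civita differentiation, curvature, the Bianchi and Ricci
identities hold for every such `A`. Covariant derivatives of tensors are evaluated on frame vectors,
whose own derivatives are given by `DV_l`, `DV_n`, `DV_p`, `DV_q`. The only values of functions that
matter are those at a single point, which enter through an algebra homomorphism `φ : A →ₐ[ℝ] ℝ`.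

The form of the Ricci tensor gives `R = 4Λ`, so the contracted Bianchi identities read
`∇ᶠ C_{fbca} = ½ (∇_c R_{ba} - ∇_a R_{bc})` (`FrameMetric.div_W`) and `∇ᵃ R_{ab} = 0`.

* *Geodeticity* (`RicTypeIII.geodetic`) already follows from the Bianchi identities. Write
  `κ = g(m, ∇_ℓ ℓ)`, `σ` for the shear and `Ψ₂` for the Weyl component of boost weight zero, in
  complex notation. The components `(ℓ, m, ℓ)` say that `κ Ψ₂ = 0`, because `∇ᶠ C_{fbca}` reduces to
  a multiple of `κ Ψ₂` while the Ricci side vanishes. The trace-free part of the components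
  `(m⁽ⁱ⁾, ℓ, m⁽ʲ⁾)` says that `κ ψ` is a multiple of `σ Ψ₂`. If `Ψ₂ = 0` then `κ ψ = 0`, and `ψ ≠ 0`; either way `κ = 0`.
* *The optical matrix* (`RicTypeIII.optical`). For constant Ricci scalar the Bach tensor is
  `½ □ R_{ab}` plus commutators of derivatives and terms quadratic in the curvature, and on the
  components `(ℓ, m⁽ⁱ⁾)` all those extra terms drop out by boost weight (`RicTypeIII.bach_eq_box`).
  Expanding `□ R_{ab}` in the frame gives a quadratic form in the optical matrix `ρ`
  (`RicTypeIII.box_p`, `RicTypeIII.box_q`). The field equations make `B(ℓ, m⁽ⁱ⁾)` vanish, and its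
  contraction with `ψ_i` is `-½ (|ρ|² |ψ|² + 2 |ρᵀ ψ|²)`, which forces `ρ = 0`.

Expansion, shear and twist are linear in `ρ`. The condition on the coupling constants is used in
`IsFrameOn.ev_bach_eq_zero` only: for `α' = 0` the field equations would make the Ricci tensor
pure trace, contrary to `ψ ≠ 0`.
-/

noncomputable section

namespace QuadraticGravity

/-! ### Covariant differentiation of multilinear maps -/

section CovDer

variable {A : Type*} [CommRing A] [Algebra ℝ A]

/-- An additive operator on the `A`-module `M` satisfying the Leibniz rule over the derivation `δ`
of `A`: the covariant derivative of sections of a bundle along a fixed vector field. -/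
structure CovDer (δ : Derivation ℝ A A) (M : Type*) [AddCommGroup M] [Module A M] where
  /-- The underlying operator. -/
  toFun : M → M
  map_add' : ∀ x y, toFun (x + y) = toFun x + toFun y
  leibniz' : ∀ (f : A) (x : M), toFun (f • x) = δ f • x + f • toFun x

namespace CovDer

variable {δ : Derivation ℝ A A} {M N : Type*} [AddCommGroup M] [Module A M]
  [AddCommGroup N] [Module A N]

instance : CoeFun (CovDer δ M) (fun _ => M → M) := ⟨CovDer.toFun⟩

@[simp] theorem map_add (D : CovDer δ M) (x y : M) : D (x + y) = D x + D y := D.map_add' x y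

@[simp] theorem leibniz (D : CovDer δ M) (f : A) (x : M) : D (f • x) = δ f • x + f • D x :=
  D.leibniz' f x

@[simp] theorem map_zero (D : CovDer δ M) : D 0 = 0 := by
  have h := D.map_add 0 0
  simpa using h

@[simp] theorem map_neg (D : CovDer δ M) (x : M) : D (-x) = -D x := by
  have h := D.map_add x (-x)
  rw [add_neg_cancel, map_zero] at h
  exact (neg_eq_of_add_eq_zero_right h.symm).symm

@[simp] theorem map_sub (D : CovDer δ M) (x y : M) : D (x - y) = D x - D y := by
  rw [sub_eq_add_neg, map_add, map_neg, sub_eq_add_neg]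

/-- A derivation, as the covariant derivative of functions. -/
def ofDerivation (δ : Derivation ℝ A A) : CovDer δ A where
  toFun := δ
  map_add' := _root_.map_add δ
  leibniz' f x := by simp [mul_comm, add_comm]

@[simp] theorem ofDerivation_apply (f : A) : ofDerivation δ f = δ f := rfl

/-- The covariant derivative of linear maps, `(D T)(x) = D (T x) - T (D x)`. -/
def hom (D : CovDer δ M) (D' : CovDer δ N) : CovDer δ (M →ₗ[A] N) where
  toFun T :=
    { toFun := fun x => D' (T x) - T (D x)
      map_add' := fun x y => by simp; abel
      map_smul' := fun f x => by simp [smul_sub] }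
  map_add' S T := by ext x; simp; abel
  leibniz' f T := by ext x; simp [smul_sub, add_sub_assoc]

@[simp] theorem hom_apply (D : CovDer δ M) (D' : CovDer δ N) (T : M →ₗ[A] N) (x : M) :
    D.hom D' T x = D' (T x) - T (D x) := rfl

end CovDer

end CovDer

/-! ### The Levi-Civita connection over a ring of functions -/

/-- Components of a vector field with respect to four coordinates, over a ring `A` of functions. -/
abbrev Vec (A : Type*) : Type _ := Fin 4 → A

/-- The `A`-linear maps from vector fields to `M`; iterating it gives the covariant tensors. -/
abbrev Cov (A : Type*) [CommRing A] (M : Type*) [AddCommGroup M] [Module A M] : Type _ :=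
  Vec A →ₗ[A] M

instance {A : Type*} [CommRing A] {M : Type*} [AddCommGroup M] [Module A M] :
    AddCommGroup (Cov A M) := LinearMap.addCommGroup

instance {A : Type*} [CommRing A] {M : Type*} [AddCommGroup M] [Module A M] :
    Module A (Cov A M) := LinearMap.module

/-- The `a`-th coordinate vector field. -/
def coordVec {A : Type*} [CommRing A] (a : Fin 4) : Vec A := Pi.single a 1

section Vec

variable {A : Type*} [CommRing A]

theorem eq_sum_coordVec (X : Vec A) : X = ∑ a, X a • coordVec a := by
  ext b
  simp [coordVec, Pi.single_apply]

theorem vec_induction {P : Vec A → Prop} (hE : ∀ a, P (coordVec a))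
    (hadd : ∀ X Y, P X → P Y → P (X + Y)) (hsmul : ∀ (f : A) X, P X → P (f • X)) (X : Vec A) :
    P X := by
  rw [eq_sum_coordVec X, Fin.sum_univ_four]
  exact hadd _ _ (hadd _ _ (hadd _ _ (hsmul _ _ (hE _)) (hsmul _ _ (hE _))) (hsmul _ _ (hE _)))
    (hsmul _ _ (hE _))

/-- Linear extension of a family indexed by the coordinate vectors. -/
abbrev ext1 {M : Type*} [AddCommGroup M] [Module A M] (v : Fin 4 → M) : Cov A M :=
  Fintype.linearCombination A v

@[simp] theorem ext1_coordVec {M : Type*} [AddCommGroup M] [Module A M] (v : Fin 4 → M)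
    (a : Fin 4) : ext1 (A := A) v (coordVec a) = v a := by
  simp [ext1, coordVec]

theorem ext1_apply {M : Type*} [AddCommGroup M] [Module A M] (v : Fin 4 → M)
    (X : Vec A) : ext1 (A := A) v X = ∑ a, X a • v a := rfl

theorem bilin_ext {M : Type*} [AddCommGroup M] [Module A M] {B B' : Cov A (Cov A M)}
    (h : ∀ a b, B (coordVec a) (coordVec b) = B' (coordVec a) (coordVec b)) : B = B' := by
  refine LinearMap.ext fun X => LinearMap.ext fun Y => ?_
  refine vec_induction (P := fun X => B X Y = B' X Y) (fun a => ?_) (fun X X' h h' => ?_)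
    (fun f X h => ?_) X
  · refine vec_induction (P := fun Y => B (coordVec a) Y = B' (coordVec a) Y) (fun b => h a b)
      (fun X X' h h' => ?_) (fun f X h => ?_) Y
    · simp [h, h']
    · simp [h]
  · simp [h, h']
  · simp [h]

/-- Three-fold use of linearity: a trilinear identity need only be checked on coordinate
vectors. -/
theorem trilin_ext {F : Vec A → Vec A → Vec A → A}
    (h1 : ∀ X X' Y Z, F (X + X') Y Z = F X Y Z + F X' Y Z)
    (h1' : ∀ (f : A) X Y Z, F (f • X) Y Z = f * F X Y Z)
    (h2 : ∀ X Y Y' Z, F X (Y + Y') Z = F X Y Z + F X Y' Z)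
    (h2' : ∀ (f : A) X Y Z, F X (f • Y) Z = f * F X Y Z)
    (h3 : ∀ X Y Z Z', F X Y (Z + Z') = F X Y Z + F X Y Z')
    (h3' : ∀ (f : A) X Y Z, F X Y (f • Z) = f * F X Y Z)
    (h : ∀ a b c, F (coordVec a) (coordVec b) (coordVec c) = 0) (X Y Z : Vec A) :
    F X Y Z = 0 := by
  refine vec_induction (P := fun X => F X Y Z = 0) (fun a => ?_)
    (fun X X' e e' => by rw [h1, e, e', add_zero]) (fun f X e => by rw [h1', e, mul_zero]) X
  refine vec_induction (P := fun Y => F _ Y Z = 0) (fun b => ?_)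
    (fun X X' e e' => by rw [h2, e, e', add_zero]) (fun f X e => by rw [h2', e, mul_zero]) Y
  exact vec_induction (P := fun Z => F _ _ Z = 0) (fun c => h a b c)
    (fun X X' e e' => by rw [h3, e, e', add_zero]) (fun f X e => by rw [h3', e, mul_zero]) Z

end Vec

/-- The algebraic data of a four-dimensional Lorentzian metric with a null frame on a coordinate
domain: an algebra `A` of functions with commuting coordinate derivations, the components of the
metric and those of the frame `ℓ, n, p = m⁽²⁾, q = m⁽³⁾`. -/
structure FrameMetric (A : Type*) [CommRing A] [Algebra ℝ A] where
  /-- The partial derivatives. -/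
  pd : Fin 4 → Derivation ℝ A A
  pd_comm : ∀ i j f, pd i (pd j f) = pd j (pd i f)
  /-- The components of the metric. -/
  G : Matrix (Fin 4) (Fin 4) A
  G_symm : ∀ a b, G a b = G b a
  /-- The first null vector. -/
  l : Vec A
  /-- The second null vector. -/
  n : Vec A
  /-- The first spacelike vector. -/
  p : Vec A
  /-- The second spacelike vector. -/
  q : Vec A
  ll : l ⬝ᵥ G.mulVec l = 0
  nn : n ⬝ᵥ G.mulVec n = 0
  ln : l ⬝ᵥ G.mulVec n = 1
  lp : l ⬝ᵥ G.mulVec p = 0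
  lq : l ⬝ᵥ G.mulVec q = 0
  np : n ⬝ᵥ G.mulVec p = 0
  nq : n ⬝ᵥ G.mulVec q = 0
  pp : p ⬝ᵥ G.mulVec p = 1
  pq : p ⬝ᵥ G.mulVec q = 0
  qq : q ⬝ᵥ G.mulVec q = 1

/-- The completeness relation of a null frame: `ℓᵃnᵇ + nᵃℓᵇ + pᵃpᵇ + qᵃqᵇ` is inverse to the
metric. -/
theorem mul_completeness_eq_one {A : Type*} [CommRing A] (G : Matrix (Fin 4) (Fin 4) A)
    (hG : ∀ a b, G a b = G b a) (l n p q : Vec A)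
    (ll : l ⬝ᵥ G.mulVec l = 0) (nn : n ⬝ᵥ G.mulVec n = 0) (ln : l ⬝ᵥ G.mulVec n = 1)
    (lp : l ⬝ᵥ G.mulVec p = 0) (lq : l ⬝ᵥ G.mulVec q = 0) (np : n ⬝ᵥ G.mulVec p = 0)
    (nq : n ⬝ᵥ G.mulVec q = 0) (pp : p ⬝ᵥ G.mulVec p = 1) (pq : p ⬝ᵥ G.mulVec q = 0)
    (qq : q ⬝ᵥ G.mulVec q = 1) :
    G * Matrix.of (fun a b => l a * n b + n a * l b + p a * p b + q a * q b) = 1 := by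
  have hsymm : ∀ x y : Vec A, x ⬝ᵥ G.mulVec y = y ⬝ᵥ G.mulVec x := fun x y => by
    have hT : G.transpose = G := by ext a b; exact hG b a
    rw [Matrix.dotProduct_mulVec, ← Matrix.mulVec_transpose, hT, dotProduct_comm]
  set F : Matrix (Fin 4) (Fin 4) A := Matrix.of ![l, n, p, q] with hF
  set K : Matrix (Fin 4) (Fin 4) A := Matrix.of ![n, l, p, q] with hK
  -- The Gram relations say that `F` and `G Kᵀ` are inverse to each other.
  have h1 : F * (G * K.transpose) = 1 := by
    have key : ∀ i j, (F * (G * K.transpose)) i j = F i ⬝ᵥ G.mulVec (K j) := fun i j => rfl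
    have nl := (hsymm n l).trans ln
    have pl := (hsymm p l).trans lp
    have ql := (hsymm q l).trans lq
    have pn := (hsymm p n).trans np
    have qn := (hsymm q n).trans nq
    have qp := (hsymm q p).trans pq
    ext i j
    rw [key, hF, hK]
    fin_cases i <;> fin_cases j <;> assumption
  have h2 : (G * K.transpose) * F = 1 := mul_eq_one_comm.mp h1
  rw [Matrix.mul_assoc] at h2
  rw [← h2]
  congr 1
  ext a b
  simp [Matrix.mul_apply, Fin.sum_univ_four, hF, hK]
  ring

namespace FrameMetric

variable {A : Type*} [CommRing A] [Algebra ℝ A] (S : FrameMetric A)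

/-- The components of the inverse metric. -/
def H (a b : Fin 4) : A := S.l a * S.n b + S.n a * S.l b + S.p a * S.p b + S.q a * S.q b

theorem H_symm (a b : Fin 4) : S.H a b = S.H b a := by simp only [H]; ring

theorem G_mul_H : S.G * Matrix.of S.H = 1 :=
  mul_completeness_eq_one S.G S.G_symm S.l S.n S.p S.q S.ll S.nn S.ln S.lp S.lq S.np S.nq S.pp
    S.pq S.qq

theorem sum_G_H (a c : Fin 4) : ∑ b, S.G a b * S.H b c = if a = c then 1 else 0 := by
  have h := congrFun (congrFun S.G_mul_H a) c
  rwa [Matrix.mul_apply, Matrix.one_apply] at h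

/-- Christoffel symbols. -/
def Γ (a b c : Fin 4) : A :=
  algebraMap ℝ A (1 / 2) * ∑ d, S.H a d *
    (S.pd b (S.G d c) + S.pd c (S.G d b) - S.pd d (S.G b c))

theorem Γ_symm (a b c : Fin 4) : S.Γ a b c = S.Γ a c b := by
  simp only [Γ, S.G_symm b c]
  congr 1
  exact Finset.sum_congr rfl fun d _ => by ring

theorem algebraMap_half_add : algebraMap ℝ A (1 / 2) + algebraMap ℝ A (1 / 2) = 1 := by
  rw [← map_add]; norm_num

theorem sum_G_Γ (a b c : Fin 4) : ∑ e, S.G a e * S.Γ e b c =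
    algebraMap ℝ A (1 / 2) * (S.pd b (S.G a c) + S.pd c (S.G a b) - S.pd a (S.G b c)) := by
  have h : ∀ e, S.G a e * S.Γ e b c = ∑ d, (S.G a e * S.H e d) * (algebraMap ℝ A (1 / 2) *
      (S.pd b (S.G d c) + S.pd c (S.G d b) - S.pd d (S.G b c))) := fun e => by
    simp only [Γ, Finset.mul_sum]
    exact Finset.sum_congr rfl fun d _ => by ring
  simp only [h]
  rw [Finset.sum_comm]
  simp only [← Finset.sum_mul, sum_G_H]
  simp

theorem pd_G (c a b : Fin 4) : S.pd c (S.G a b) =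
    ∑ d, S.Γ d c a * S.G d b + ∑ d, S.Γ d c b * S.G a d := by
  have h1 := S.sum_G_Γ a c b
  have h2 := S.sum_G_Γ b c a
  have e1 : ∑ d, S.Γ d c a * S.G d b = ∑ e, S.G b e * S.Γ e c a :=
    Finset.sum_congr rfl fun d _ => by rw [S.G_symm d b, mul_comm]
  have e2 : ∑ d, S.Γ d c b * S.G a d = ∑ e, S.G a e * S.Γ e c b :=
    Finset.sum_congr rfl fun d _ => by rw [mul_comm]
  rw [e1, e2, h1, h2, S.G_symm c a, S.G_symm c b, S.G_symm b a]
  linear_combination -(S.pd c (S.G a b)) * algebraMap_half_add (A := A)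

/-- The Levi-Civita covariant derivative of vector fields along the `c`-th coordinate vector. -/
def DX (c : Fin 4) : CovDer (S.pd c) (Vec A) where
  toFun X := fun a => S.pd c (X a) + ∑ b, S.Γ a c b * X b
  map_add' X Y := by
    ext a
    simp only [Pi.add_apply, map_add, mul_add, Finset.sum_add_distrib]; ring
  leibniz' f X := by
    ext a
    simp only [Pi.add_apply, Pi.smul_apply, smul_eq_mul, Derivation.leibniz, mul_add,
      Finset.mul_sum, mul_left_comm f, mul_comm (X a)]
    ring

theorem DX_apply (c : Fin 4) (X : Vec A) (a : Fin 4) :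
    S.DX c X a = S.pd c (X a) + ∑ b, S.Γ a c b * X b := rfl

theorem DX_coordVec (c b : Fin 4) : S.DX c (coordVec b) = ∑ d, S.Γ d c b • coordVec d := by
  ext a
  simp only [DX_apply, coordVec, Finset.sum_apply, Pi.smul_apply, smul_eq_mul, Pi.single_apply]
  by_cases h : a = b <;> simp [h]

theorem DX_coordVec_comm (c b : Fin 4) : S.DX c (coordVec b) = S.DX b (coordVec c) := by
  simp only [DX_coordVec, S.Γ_symm _ c b]

/-- Covariant derivative of functions along the `c`-th coordinate vector. -/
abbrev D0 (c : Fin 4) : CovDer (S.pd c) A := CovDer.ofDerivation (S.pd c)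

/-- Covariant derivative of covectors along the `c`-th coordinate vector. -/
abbrev D1 (c : Fin 4) : CovDer (S.pd c) (Cov A A) := (S.DX c).hom (S.D0 c)

/-- Covariant derivative of covariant tensors of rank two along the `c`-th coordinate vector. -/
abbrev D2 (c : Fin 4) : CovDer (S.pd c) (Cov A (Cov A A)) := (S.DX c).hom (S.D1 c)

/-- Covariant derivative of covariant tensors of rank three along the `c`-th coordinate vector. -/
abbrev D3 (c : Fin 4) : CovDer (S.pd c) (Cov A (Cov A (Cov A A))) := (S.DX c).hom (S.D2 c)

/-- Covariant derivative of covariant tensors of rank four along the `c`-th coordinate vector. -/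
abbrev D4 (c : Fin 4) : CovDer (S.pd c) (Cov A (Cov A (Cov A (Cov A A)))) :=
  (S.DX c).hom (S.D3 c)

/-- Covariant derivative of covariant tensors of rank five along the `c`-th coordinate vector. -/
abbrev D5 (c : Fin 4) : CovDer (S.pd c) (Cov A (Cov A (Cov A (Cov A (Cov A A))))) :=
  (S.DX c).hom (S.D4 c)

/-- The metric as a bilinear map. -/
def g : Cov A (Cov A A) := ext1 fun a => ext1 fun b => S.G a b

@[simp] theorem g_coordVec (a b : Fin 4) : S.g (coordVec a) (coordVec b) = S.G a b := by
  simp [g]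

theorem g_eq_dotProduct (X Y : Vec A) : S.g X Y = X ⬝ᵥ S.G.mulVec Y := by
  simp only [g, ext1_apply, LinearMap.sum_apply, LinearMap.smul_apply, smul_eq_mul, dotProduct,
    Matrix.mulVec]
  exact Finset.sum_congr rfl fun a _ => by simp only [mul_comm]

theorem g_symm (X Y : Vec A) : S.g X Y = S.g Y X := by
  refine vec_induction (P := fun X => S.g X Y = S.g Y X) (fun a => ?_) (fun X X' h h' => ?_)
    (fun f X h => ?_) X
  · refine vec_induction (P := fun Y => S.g (coordVec a) Y = S.g Y (coordVec a)) (fun b => ?_)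
      (fun X X' h h' => ?_) (fun f X h => ?_) Y
    · simp [S.G_symm a b]
    · simp [h, h']
    · simp [h]
  · simp [h, h']
  · simp [h]

/-- The metric is covariantly constant. -/
theorem D2_g (c : Fin 4) : S.D2 c S.g = 0 := by
  refine bilin_ext fun a b => ?_
  simp only [CovDer.hom_apply, LinearMap.sub_apply, DX_coordVec, map_sum, map_smul,
    LinearMap.sum_apply, LinearMap.smul_apply, g_coordVec, CovDer.ofDerivation_apply, smul_eq_mul,
    LinearMap.zero_apply, S.pd_G c a b]
  ring

theorem pd_g (c : Fin 4) (X Y : Vec A) :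
    S.pd c (S.g X Y) = S.g (S.DX c X) Y + S.g X (S.DX c Y) := by
  have h := congrArg (fun T => T X Y) (S.D2_g c)
  simp only [CovDer.hom_apply, LinearMap.sub_apply, CovDer.ofDerivation_apply,
    LinearMap.zero_apply] at h
  linear_combination h

end FrameMetric

/-! ### Curvature and the Bianchi identities -/

namespace FrameMetric

variable {A : Type*} [CommRing A] [Algebra ℝ A] (S : FrameMetric A)

/-- The curvature operator `[D_c, D_d]` on vector fields. -/
def curv (c d : Fin 4) : Vec A →ₗ[A] Vec A where
  toFun X := S.DX c (S.DX d X) - S.DX d (S.DX c X)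
  map_add' X Y := by simp only [CovDer.map_add]; abel
  map_smul' f X := by
    simp only [CovDer.leibniz, CovDer.map_add, S.pd_comm c d f, RingHom.id_apply, smul_sub]; abel

theorem curv_apply (c d : Fin 4) (X : Vec A) :
    S.curv c d X = S.DX c (S.DX d X) - S.DX d (S.DX c X) := rfl

/-- The curvature tensor `Rᵃ_{bcd}` in terms of Christoffel symbols. -/
def Rup (a b c d : Fin 4) : A :=
  S.pd c (S.Γ a d b) - S.pd d (S.Γ a c b)
    + ∑ e, (S.Γ a c e * S.Γ e d b - S.Γ a d e * S.Γ e c b)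

theorem curv_coordVec (a b c d : Fin 4) : S.curv c d (coordVec b) a = S.Rup a b c d := by
  have h : ∀ c d : Fin 4, S.DX c (S.DX d (coordVec b)) a =
      S.pd c (S.Γ a d b) + ∑ e, S.Γ a c e * S.Γ e d b := fun c d => by
    rw [DX_apply]
    have h' : ∀ e, S.DX d (coordVec b) e = S.Γ e d b := fun e => by
      rw [DX_coordVec]; simp [coordVec, Pi.single_apply]
    simp only [h']
  rw [curv_apply, Pi.sub_apply, h, h, Rup, Finset.sum_sub_distrib]
  ring

/-- The fully covariant curvature tensor, with `Rm X Y Z W = g(X, [D_Z, D_W] Y)`. -/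
def Rm : Cov A (Cov A (Cov A (Cov A A))) :=
  ext1 fun a => ext1 fun b => ext1 fun c => ext1 fun d => ∑ e, S.G a e * S.Rup e b c d

theorem Rm_coordVec (X Y : Vec A) (c d : Fin 4) :
    S.Rm X Y (coordVec c) (coordVec d) = S.g X (S.curv c d Y) := by
  refine vec_induction (P := fun X => S.Rm X Y (coordVec c) (coordVec d) = S.g X (S.curv c d Y))
    (fun a => ?_) (fun X X' h h' => by simp [h, h']) (fun f X h => by simp [h]) X
  refine vec_induction (P := fun Y => S.Rm (coordVec a) Y (coordVec c) (coordVec d) =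
    S.g (coordVec a) (S.curv c d Y)) (fun b => ?_) (fun X X' h h' => by simp [h, h'])
    (fun f X h => by simp [h]) Y
  rw [eq_sum_coordVec (S.curv c d (coordVec b))]
  simp only [Rm, ext1_coordVec, map_sum, map_smul, g_coordVec, curv_coordVec, smul_eq_mul]
  exact Finset.sum_congr rfl fun e _ => mul_comm _ _

theorem curv_swap (c d : Fin 4) (X : Vec A) : S.curv d c X = -S.curv c d X := by
  simp [curv_apply]

theorem Rm_antisymm_right (X Y Z W : Vec A) : S.Rm X Y W Z = -S.Rm X Y Z W := by
  have h : LinearMap.flip (S.Rm X Y) = -S.Rm X Y := by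
    refine bilin_ext fun c d => ?_
    simp only [LinearMap.flip_apply, LinearMap.neg_apply, Rm_coordVec, S.curv_swap c d, map_neg]
  exact congrArg (fun B => B Z W) h

theorem g_curv (c d : Fin 4) (X Y : Vec A) : S.g Y (S.curv c d X) = -S.g X (S.curv c d Y) := by
  have h := S.pd_comm c d (S.g X Y)
  simp only [pd_g, map_add] at h
  rw [S.g_symm Y]
  simp only [curv_apply, map_sub, LinearMap.sub_apply]
  linear_combination h

theorem Rm_antisymm_left (X Y Z W : Vec A) : S.Rm Y X Z W = -S.Rm X Y Z W := by
  have h : S.Rm Y X = -S.Rm X Y := by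
    refine bilin_ext fun c d => ?_
    simp only [LinearMap.neg_apply, Rm_coordVec, S.g_curv c d X Y]
  exact congrArg (fun B => B Z W) h

/-- The first Bianchi identity. -/
theorem Rm_cyclic (X Y Z W : Vec A) : S.Rm X Y Z W + S.Rm X Z W Y + S.Rm X W Y Z = 0 := by
  refine trilin_ext (F := fun Y Z W => S.Rm X Y Z W + S.Rm X Z W Y + S.Rm X W Y Z)
    ?_ ?_ ?_ ?_ ?_ ?_ (fun b c d => ?_) Y Z W
  any_goals
    intros
    simp only [map_add, map_smul, LinearMap.add_apply, LinearMap.smul_apply, smul_eq_mul]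
    ring
  simp only [Rm_coordVec, ← map_add, curv_apply, S.DX_coordVec_comm c d, S.DX_coordVec_comm b c,
    S.DX_coordVec_comm b d]
  convert map_zero (S.g X) using 2
  abel

/-- The pair symmetry of the curvature tensor. -/
theorem Rm_pair_symm (X Y Z W : Vec A) : S.Rm Z W X Y = S.Rm X Y Z W := by
  have a := fun P Q R T => S.Rm_antisymm_left (A := A) P Q R T
  have b := fun P Q R T => S.Rm_antisymm_right (A := A) P Q R T
  have e : (2 : A) * (S.Rm Z W X Y - S.Rm X Y Z W) = 0 := by
    linear_combination S.Rm_cyclic Z W X Y - S.Rm_cyclic W X Y Z - S.Rm_cyclic X Y Z W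
      + S.Rm_cyclic Y Z W X - b Y Z X W - a W Y X Z - a X Y Z W - a X Z Y W + b X Z W Y
      - a Y Z W X + b Y Z X W + a X W Y Z + b W Y X Z + a Z W X Y
  have h2 : algebraMap ℝ A (1 / 2) * 2 = 1 := by
    linear_combination algebraMap_half_add (A := A)
  linear_combination algebraMap ℝ A (1 / 2) * e - (S.Rm Z W X Y - S.Rm X Y Z W) * h2

/-- The covariant derivative `∇T`, with the direction of differentiation as first argument. -/
def nabla {M : Type*} [AddCommGroup M] [Module A M] (D : ∀ c, CovDer (S.pd c) M) (T : M) :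
    Cov A M := ext1 fun c => D c T

@[simp] theorem nabla_coordVec {M : Type*} [AddCommGroup M] [Module A M]
    (D : ∀ c, CovDer (S.pd c) M) (T : M) (c : Fin 4) : S.nabla D T (coordVec c) = D c T := by
  simp [nabla]

/-- The second Bianchi identity. -/
theorem nabla_Rm_cyclic (V X Y Z W : Vec A) :
    S.nabla S.D4 S.Rm V X Y Z W + S.nabla S.D4 S.Rm Z X Y W V + S.nabla S.D4 S.Rm W X Y V Z
      = 0 := by
  refine trilin_ext (F := fun V Z W => S.nabla S.D4 S.Rm V X Y Z W + S.nabla S.D4 S.Rm Z X Y W V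
    + S.nabla S.D4 S.Rm W X Y V Z) ?_ ?_ ?_ ?_ ?_ ?_ (fun e c d => ?_) V Z W
  any_goals
    intros
    simp only [map_add, map_smul, LinearMap.add_apply, LinearMap.smul_apply, smul_eq_mul]
    ring
  have key : ∀ e c d : Fin 4, S.nabla S.D4 S.Rm (coordVec e) X Y (coordVec c) (coordVec d) =
      S.g X (S.DX e (S.curv c d Y) - S.curv c d (S.DX e Y))
        - S.Rm X Y (S.DX e (coordVec c)) (coordVec d)
        + S.Rm X Y (S.DX e (coordVec d)) (coordVec c) := fun e c d => by
    rw [nabla_coordVec, S.Rm_antisymm_right X Y (coordVec c) (S.DX e (coordVec d))]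
    simp only [CovDer.hom_apply, LinearMap.sub_apply, Rm_coordVec, CovDer.ofDerivation_apply, pd_g,
      map_sub]
    ring
  simp only [key, curv_apply, CovDer.map_sub, map_sub, S.DX_coordVec_comm c d,
    S.DX_coordVec_comm e c, S.DX_coordVec_comm e d]
  ring

/-- The curvature operator along two vector fields. -/
def Rv : Cov A (Cov A (Cov A (Vec A))) := ext1 fun c => ext1 fun d => S.curv c d

theorem g_Rv (V W X Y : Vec A) : S.g Y (S.Rv V W X) = S.Rm Y X V W := by
  have h := trilin_ext (F := fun V W X => S.g Y (S.Rv V W X) - S.Rm Y X V W)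
    ?_ ?_ ?_ ?_ ?_ ?_ (fun e c d => ?_) V W X
  any_goals
    intros
    simp only [map_add, map_smul, LinearMap.add_apply, LinearMap.smul_apply, smul_eq_mul]
    ring
  · linear_combination h
  · simp [Rm_coordVec, Rv]

/-- The Ricci identity for covariant tensors of rank two. -/
theorem ricci_identity (T : Cov A (Cov A A)) (V W X Y : Vec A) :
    S.nabla S.D3 (S.nabla S.D2 T) V W X Y - S.nabla S.D3 (S.nabla S.D2 T) W V X Y =
      -T (S.Rv V W X) Y - T X (S.Rv V W Y) := by
  refine vec_induction (P := fun V => S.nabla S.D3 (S.nabla S.D2 T) V W X Y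
    - S.nabla S.D3 (S.nabla S.D2 T) W V X Y = -T (S.Rv V W X) Y - T X (S.Rv V W Y))
    (fun c => ?_) (fun V V' h h' => ?_) (fun f V h => ?_) V
  · refine vec_induction (P := fun W => S.nabla S.D3 (S.nabla S.D2 T) (coordVec c) W X Y
      - S.nabla S.D3 (S.nabla S.D2 T) W (coordVec c) X Y =
      -T (S.Rv (coordVec c) W X) Y - T X (S.Rv (coordVec c) W Y))
      (fun d => ?_) (fun V V' h h' => ?_) (fun f V h => ?_) W
    · have hd := S.pd_comm c d (T X Y)
      simp only [nabla_coordVec, CovDer.hom_apply, LinearMap.sub_apply, CovDer.ofDerivation_apply,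
        Rv, ext1_coordVec, curv_apply, map_sub, S.DX_coordVec_comm c d]
      linear_combination hd
    · simp only [map_add, LinearMap.add_apply]
      linear_combination h + h'
    · simp only [map_smul, LinearMap.smul_apply, smul_eq_mul]
      linear_combination f * h
  · simp only [map_add, LinearMap.add_apply]
    linear_combination h + h'
  · simp only [map_smul, LinearMap.smul_apply, smul_eq_mul]
    linear_combination f * h

end FrameMetric

/-! ### The null frame and traces -/

namespace FrameMetric

variable {A : Type*} [CommRing A] [Algebra ℝ A] (S : FrameMetric A)

theorem g_ll : S.g S.l S.l = 0 := by rw [g_eq_dotProduct, S.ll]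
theorem g_nn : S.g S.n S.n = 0 := by rw [g_eq_dotProduct, S.nn]
theorem g_ln : S.g S.l S.n = 1 := by rw [g_eq_dotProduct, S.ln]
theorem g_lp : S.g S.l S.p = 0 := by rw [g_eq_dotProduct, S.lp]
theorem g_lq : S.g S.l S.q = 0 := by rw [g_eq_dotProduct, S.lq]
theorem g_np : S.g S.n S.p = 0 := by rw [g_eq_dotProduct, S.np]
theorem g_nq : S.g S.n S.q = 0 := by rw [g_eq_dotProduct, S.nq]
theorem g_pp : S.g S.p S.p = 1 := by rw [g_eq_dotProduct, S.pp]
theorem g_pq : S.g S.p S.q = 0 := by rw [g_eq_dotProduct, S.pq]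
theorem g_qq : S.g S.q S.q = 1 := by rw [g_eq_dotProduct, S.qq]
theorem g_nl : S.g S.n S.l = 1 := by rw [g_symm, g_ln]
theorem g_pl : S.g S.p S.l = 0 := by rw [g_symm, g_lp]
theorem g_ql : S.g S.q S.l = 0 := by rw [g_symm, g_lq]
theorem g_pn : S.g S.p S.n = 0 := by rw [g_symm, g_np]
theorem g_qn : S.g S.q S.n = 0 := by rw [g_symm, g_nq]
theorem g_qp : S.g S.q S.p = 0 := by rw [g_symm, g_pq]

/-- Expansion of a vector field in the null frame. -/
theorem frame_expansion (X : Vec A) :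
    X = S.g S.n X • S.l + S.g S.l X • S.n + S.g S.p X • S.p + S.g S.q X • S.q := by
  have hT : S.G.transpose = S.G := by ext a b; exact S.G_symm b a
  have hg : ∀ Y, S.g Y X = ∑ b, Y b * (S.G.mulVec X) b := fun Y => by
    rw [g_eq_dotProduct]; rfl
  have h : Matrix.of S.H * S.G = 1 := mul_eq_one_comm.mp S.G_mul_H
  ext a
  have h1 : X a = ∑ b, S.H a b * (S.G.mulVec X) b := by
    calc X a = ((Matrix.of S.H * S.G).mulVec X) a := by rw [h, Matrix.one_mulVec]
      _ = _ := by rw [← Matrix.mulVec_mulVec]; rfl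
  rw [h1]
  simp only [Pi.add_apply, Pi.smul_apply, smul_eq_mul, hg, H, Finset.sum_mul,
    ← Finset.sum_add_distrib]
  exact Finset.sum_congr rfl fun b _ => by ring

/-- The covariant derivative of a vector field along another one. -/
abbrev DV (V X : Vec A) : Vec A := S.nabla S.DX X V

section nabla

variable {M : Type*} [AddCommGroup M] [Module A M]

theorem nabla_apply (D : ∀ c, CovDer (S.pd c) M) (T : M) (V : Vec A) :
    S.nabla D T V = ∑ c, V c • D c T := rfl

theorem nabla_hom (D : ∀ c, CovDer (S.pd c) M) (T : Cov A M) (V X : Vec A) :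
    S.nabla (fun c => (S.DX c).hom (D c)) T V X =
      S.nabla D (T X) V - T (S.DV V X) := by
  simp only [DV, nabla_apply, LinearMap.sum_apply, LinearMap.smul_apply, CovDer.hom_apply, smul_sub,
    Finset.sum_sub_distrib, map_sum, map_smul]

theorem nabla_add (D : ∀ c, CovDer (S.pd c) M) (T T' : M) (V : Vec A) :
    S.nabla D (T + T') V = S.nabla D T V + S.nabla D T' V := by
  simp only [nabla_apply, CovDer.map_add, smul_add, Finset.sum_add_distrib]

theorem nabla_smul (D : ∀ c, CovDer (S.pd c) M) (f : A) (T : M) (V : Vec A) :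
    S.nabla D (f • T) V = S.nabla S.D0 f V • T + f • S.nabla D T V := by
  simp only [nabla_apply, CovDer.leibniz, smul_add, Finset.sum_add_distrib, Finset.smul_sum,
    Finset.sum_smul, CovDer.ofDerivation_apply, smul_smul, smul_eq_mul, mul_comm f]

end nabla

/-- The derivative of a function along a vector field. -/
abbrev dir (V : Vec A) (f : A) : A := S.nabla S.D0 f V

theorem dir_add (V : Vec A) (f f' : A) : S.dir V (f + f') = S.dir V f + S.dir V f' :=
  S.nabla_add S.D0 f f' V

theorem dir_mul (V : Vec A) (f f' : A) : S.dir V (f * f') = S.dir V f * f' + f * S.dir V f' :=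
  S.nabla_smul S.D0 f f' V

theorem dir_algebraMap (V : Vec A) (r : ℝ) : S.dir V (algebraMap ℝ A r) = 0 := by
  simp [nabla_apply]

theorem dir_zero (V : Vec A) : S.dir V 0 = 0 := by
  simp [nabla_apply]

theorem dir_one (V : Vec A) : S.dir V 1 = 0 := by
  simp [nabla_apply]

theorem dir_neg (V : Vec A) (f : A) : S.dir V (-f) = -S.dir V f := by
  simp [nabla_apply]

theorem dir_sub (V : Vec A) (f f' : A) : S.dir V (f - f') = S.dir V f - S.dir V f' := by
  rw [sub_eq_add_neg, dir_add, dir_neg, sub_eq_add_neg]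

theorem dir_g (V X Y : Vec A) : S.dir V (S.g X Y) = S.g (S.DV V X) Y + S.g X (S.DV V Y) := by
  simp only [nabla_apply, CovDer.ofDerivation_apply, pd_g, map_sum, map_smul, LinearMap.sum_apply,
    LinearMap.smul_apply, smul_add, Finset.sum_add_distrib]

theorem nabla_D1 (T : Cov A A) (V X : Vec A) :
    S.nabla S.D1 T V X = S.dir V (T X) - T (S.DV V X) := S.nabla_hom _ _ _ _

theorem nabla_D2 (T : Cov A (Cov A A)) (V X Y : Vec A) :
    S.nabla S.D2 T V X Y = S.dir V (T X Y) - T X (S.DV V Y) - T (S.DV V X) Y := by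
  rw [nabla_hom S S.D1, LinearMap.sub_apply, nabla_D1]

theorem nabla_D3 (T : Cov A (Cov A (Cov A A))) (V X Y Z : Vec A) :
    S.nabla S.D3 T V X Y Z = S.dir V (T X Y Z) - T X Y (S.DV V Z) - T X (S.DV V Y) Z
      - T (S.DV V X) Y Z := by
  rw [nabla_hom S S.D2, LinearMap.sub_apply, LinearMap.sub_apply, nabla_D2]

theorem nabla_D4 (T : Cov A (Cov A (Cov A (Cov A A)))) (V X Y Z W : Vec A) :
    S.nabla S.D4 T V X Y Z W = S.dir V (T X Y Z W) - T X Y Z (S.DV V W) - T X Y (S.DV V Z) W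
      - T X (S.DV V Y) Z W - T (S.DV V X) Y Z W := by
  rw [nabla_hom S S.D3, LinearMap.sub_apply, LinearMap.sub_apply, LinearMap.sub_apply, nabla_D3]

theorem nabla_D5 (T : Cov A (Cov A (Cov A (Cov A (Cov A A))))) (V X Y Z W U : Vec A) :
    S.nabla S.D5 T V X Y Z W U = S.dir V (T X Y Z W U) - T X Y Z W (S.DV V U)
      - T X Y Z (S.DV V W) U - T X Y (S.DV V Z) W U - T X (S.DV V Y) Z W U
      - T (S.DV V X) Y Z W U := by
  rw [nabla_hom S S.D4, LinearMap.sub_apply, LinearMap.sub_apply, LinearMap.sub_apply,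
    LinearMap.sub_apply, nabla_D4]

/-- The connection coefficients of the null frame along `V`: the covariant derivatives of the
frame vectors are determined by six functions. -/
theorem DV_l (V : Vec A) : S.DV V S.l = S.g S.n (S.DV V S.l) • S.l + S.g S.p (S.DV V S.l) • S.p
    + S.g S.q (S.DV V S.l) • S.q := by
  have h := S.dir_g V S.l S.l
  have e := S.frame_expansion (S.DV V S.l)
  have h0 : S.g S.l (S.DV V S.l) = 0 := by
    rw [g_ll, dir_zero, S.g_symm (S.DV V S.l)] at h
    linear_combination -(S.g S.l (S.DV V S.l)) * algebraMap_half_add (A := A)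
      - algebraMap ℝ A (1 / 2) * h
  rw [h0] at e
  simpa using e

theorem DV_n (V : Vec A) : S.DV V S.n = -S.g S.n (S.DV V S.l) • S.n + S.g S.p (S.DV V S.n) • S.p
    + S.g S.q (S.DV V S.n) • S.q := by
  have h := S.dir_g V S.n S.n
  have h1 := S.dir_g V S.l S.n
  have e := S.frame_expansion (S.DV V S.n)
  have h0 : S.g S.n (S.DV V S.n) = 0 := by
    rw [g_nn, dir_zero, S.g_symm (S.DV V S.n)] at h
    linear_combination -(S.g S.n (S.DV V S.n)) * algebraMap_half_add (A := A)
      - algebraMap ℝ A (1 / 2) * h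
  have h2 : S.g S.l (S.DV V S.n) = -S.g S.n (S.DV V S.l) := by
    rw [g_ln, dir_one, S.g_symm (S.DV V S.l)] at h1
    linear_combination -h1
  rw [h0, h2] at e
  simpa using e

theorem DV_p (V : Vec A) : S.DV V S.p = -S.g S.p (S.DV V S.n) • S.l - S.g S.p (S.DV V S.l) • S.n
    + S.g S.q (S.DV V S.p) • S.q := by
  have h := S.dir_g V S.p S.p
  have h1 := S.dir_g V S.l S.p
  have h2 := S.dir_g V S.n S.p
  have e := S.frame_expansion (S.DV V S.p)
  have h0 : S.g S.p (S.DV V S.p) = 0 := by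
    rw [g_pp, dir_one, S.g_symm (S.DV V S.p)] at h
    linear_combination -(S.g S.p (S.DV V S.p)) * algebraMap_half_add (A := A)
      - algebraMap ℝ A (1 / 2) * h
  have h3 : S.g S.l (S.DV V S.p) = -S.g S.p (S.DV V S.l) := by
    rw [g_lp, dir_zero, S.g_symm (S.DV V S.l)] at h1
    linear_combination -h1
  have h4 : S.g S.n (S.DV V S.p) = -S.g S.p (S.DV V S.n) := by
    rw [g_np, dir_zero, S.g_symm (S.DV V S.n)] at h2
    linear_combination -h2
  rw [h0, h3, h4] at e
  simpa [sub_eq_add_neg] using e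

theorem DV_q (V : Vec A) : S.DV V S.q = -S.g S.q (S.DV V S.n) • S.l - S.g S.q (S.DV V S.l) • S.n
    - S.g S.q (S.DV V S.p) • S.p := by
  have h := S.dir_g V S.q S.q
  have h1 := S.dir_g V S.l S.q
  have h2 := S.dir_g V S.n S.q
  have h5 := S.dir_g V S.p S.q
  have e := S.frame_expansion (S.DV V S.q)
  have h0 : S.g S.q (S.DV V S.q) = 0 := by
    rw [g_qq, dir_one, S.g_symm (S.DV V S.q)] at h
    linear_combination -(S.g S.q (S.DV V S.q)) * algebraMap_half_add (A := A)
      - algebraMap ℝ A (1 / 2) * h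
  have h3 : S.g S.l (S.DV V S.q) = -S.g S.q (S.DV V S.l) := by
    rw [g_lq, dir_zero, S.g_symm (S.DV V S.l)] at h1
    linear_combination -h1
  have h4 : S.g S.n (S.DV V S.q) = -S.g S.q (S.DV V S.n) := by
    rw [g_nq, dir_zero, S.g_symm (S.DV V S.n)] at h2
    linear_combination -h2
  have h6 : S.g S.p (S.DV V S.q) = -S.g S.q (S.DV V S.p) := by
    rw [g_pq, dir_zero, S.g_symm (S.DV V S.p)] at h5
    linear_combination -h5
  rw [h0, h3, h4, h6] at e
  simpa [sub_eq_add_neg] using e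

section trace

variable {M : Type*} [AddCommGroup M] [Module A M]

/-- The metric trace of the first two arguments. -/
def tr (T : Cov A (Cov A M)) : M := ∑ a, ∑ b, S.H a b • T (coordVec a) (coordVec b)

/-- The metric trace in the null frame. -/
theorem tr_eq (T : Cov A (Cov A M)) :
    S.tr T = T S.l S.n + T S.n S.l + T S.p S.p + T S.q S.q := by
  have h : ∀ X Y : Vec A, T X Y = ∑ a, ∑ b, (X a * Y b) • T (coordVec a) (coordVec b) :=
    fun X Y => by
      conv_lhs => rw [eq_sum_coordVec X, eq_sum_coordVec Y]
      simp only [map_sum, map_smul, LinearMap.sum_apply, LinearMap.smul_apply, smul_smul,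
        Finset.smul_sum]
      rw [Finset.sum_comm]
      simp only [mul_comm]
  rw [h S.l, h S.n, h S.p, h S.q]
  simp only [tr, H, add_smul, Finset.sum_add_distrib]

/-- Covariant differentiation commutes with the metric trace. -/
theorem nabla_tr (D : ∀ c, CovDer (S.pd c) M) (T : Cov A (Cov A M)) (V : Vec A) :
    S.nabla D (S.tr T) V =
      S.tr (S.nabla (fun c => (S.DX c).hom ((S.DX c).hom (D c))) T V) := by
  simp only [tr_eq, nabla_add, nabla_hom S (fun c => (S.DX c).hom (D c)), LinearMap.sub_apply,
    nabla_hom S D]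
  rw [S.DV_l, S.DV_n, S.DV_p, S.DV_q]
  simp only [map_add, map_sub, map_smul, LinearMap.add_apply, LinearMap.sub_apply,
    LinearMap.smul_apply]
  module

end trace

end FrameMetric

/-! ### Contracted Bianchi identities -/

namespace FrameMetric

variable {A : Type*} [CommRing A] [Algebra ℝ A] (S : FrameMetric A)

/-- The Ricci tensor. -/
def Ric : Cov A (Cov A A) := ext1 fun a => ext1 fun b => ∑ c, S.Rup c a c b

/-- The Ricci tensor as the trace of the curvature tensor in the null frame. -/
theorem Ric_eq (X Y : Vec A) : S.Ric X Y =
    S.Rm S.l X S.n Y + S.Rm S.n X S.l Y + S.Rm S.p X S.p Y + S.Rm S.q X S.q Y := by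
  have key : ∀ a b, S.Ric (coordVec a) (coordVec b) =
      S.tr (ext1 fun e => ext1 fun c => S.Rm (coordVec e) (coordVec a) (coordVec c)
        (coordVec b)) := fun a b => by
    have h : ∀ c, ∑ e, S.H e c * ∑ f, S.G e f * S.Rup f a c b = S.Rup c a c b := fun c => by
      have h' : ∀ e, S.H e c * ∑ f, S.G e f * S.Rup f a c b =
          ∑ f, (S.G f e * S.H e c) * S.Rup f a c b := fun e => by
        rw [Finset.mul_sum]
        exact Finset.sum_congr rfl fun f _ => by rw [S.G_symm f e]; ring
      simp only [h']
      rw [Finset.sum_comm]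
      simp only [← Finset.sum_mul, sum_G_H]
      simp
    simp only [tr, Ric, Rm, ext1_coordVec, smul_eq_mul]
    rw [Finset.sum_comm]
    exact Finset.sum_congr rfl fun c _ => (h c).symm
  have hB : ∀ (X Y V W : Vec A), (ext1 fun e => ext1 fun c => S.Rm (coordVec e) X
      (coordVec c) Y : Cov A (Cov A A)) V W = S.Rm V X W Y := fun X Y V W => by
    refine vec_induction (P := fun V => (ext1 fun e => ext1 fun c => S.Rm (coordVec e) X
      (coordVec c) Y : Cov A (Cov A A)) V W = S.Rm V X W Y) (fun e => ?_)
      (fun _ _ h h' => by rw [map_add, LinearMap.add_apply, h, h']; simp)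
      (fun f _ h => by rw [map_smul, LinearMap.smul_apply, h]; simp) V
    refine vec_induction (P := fun W => (ext1 fun e => ext1 fun c => S.Rm (coordVec e) X
      (coordVec c) Y : Cov A (Cov A A)) (coordVec e) W = S.Rm (coordVec e) X W Y)
      (fun c => by rw [ext1_coordVec, ext1_coordVec])
      (fun _ _ h h' => by rw [map_add, h, h']; simp)
      (fun f _ h => by rw [map_smul, h]; simp) W
  refine vec_induction (P := fun X => S.Ric X Y =
    S.Rm S.l X S.n Y + S.Rm S.n X S.l Y + S.Rm S.p X S.p Y + S.Rm S.q X S.q Y)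
    (fun a => ?_) (fun X X' h h' => ?_) (fun f X h => ?_) X
  · refine vec_induction (P := fun Y => S.Ric (coordVec a) Y = S.Rm S.l (coordVec a) S.n Y
      + S.Rm S.n (coordVec a) S.l Y + S.Rm S.p (coordVec a) S.p Y + S.Rm S.q (coordVec a) S.q Y)
      (fun b => ?_) (fun X X' h h' => ?_) (fun f X h => ?_) Y
    · rw [key, tr_eq]
      simp only [hB]
    · rw [map_add, h, h']; simp only [map_add]; ring
    · rw [map_smul, h]; simp only [map_smul, smul_eq_mul]; ring
  · rw [map_add, LinearMap.add_apply, h, h']; simp only [map_add, LinearMap.add_apply]; ring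
  · rw [map_smul, LinearMap.smul_apply, h]
    simp only [map_smul, LinearMap.smul_apply, smul_eq_mul]; ring

theorem Ric_symm (X Y : Vec A) : S.Ric X Y = S.Ric Y X := by
  rw [Ric_eq, Ric_eq, S.Rm_pair_symm S.l X S.n Y, S.Rm_pair_symm S.n X S.l Y,
    S.Rm_pair_symm S.p X S.p Y, S.Rm_pair_symm S.q X S.q Y]
  ring

/-- The Ricci scalar. -/
def scal : A := S.tr S.Ric

/-- Covariant derivative of the Ricci tensor as the trace of that of the curvature tensor. -/
theorem nabla_Ric (V X Y : Vec A) : S.nabla S.D2 S.Ric V X Y =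
    S.nabla S.D4 S.Rm V S.l X S.n Y + S.nabla S.D4 S.Rm V S.n X S.l Y
      + S.nabla S.D4 S.Rm V S.p X S.p Y + S.nabla S.D4 S.Rm V S.q X S.q Y := by
  simp only [nabla_D2, nabla_D4, Ric_eq, dir_add]
  rw [S.DV_l, S.DV_n, S.DV_p, S.DV_q]
  simp only [map_add, map_sub, map_smul, LinearMap.add_apply, LinearMap.sub_apply,
    LinearMap.smul_apply, smul_eq_mul]
  ring

theorem nabla_Rm_antisymm_right (V X Y Z W : Vec A) :
    S.nabla S.D4 S.Rm V X Y W Z = -S.nabla S.D4 S.Rm V X Y Z W := by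
  simp only [nabla_D4, S.Rm_antisymm_right _ _ Z, S.Rm_antisymm_right _ _ (S.DV V Z),
    dir_neg]
  ring

theorem nabla_Rm_pair_symm (V X Y Z W : Vec A) :
    S.nabla S.D4 S.Rm V Z W X Y = S.nabla S.D4 S.Rm V X Y Z W := by
  simp only [nabla_D4]
  rw [S.Rm_pair_symm X Y Z W, S.Rm_pair_symm X (S.DV V Y) Z W, S.Rm_pair_symm (S.DV V X) Y Z W,
    S.Rm_pair_symm X Y Z (S.DV V W), S.Rm_pair_symm X Y (S.DV V Z) W]
  ring

theorem nabla_Ric_symm (V X Y : Vec A) :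
    S.nabla S.D2 S.Ric V X Y = S.nabla S.D2 S.Ric V Y X := by
  rw [nabla_D2, nabla_D2, S.Ric_symm X Y, S.Ric_symm X, S.Ric_symm _ Y]
  ring

/-- The once contracted Bianchi identity `∇ᶠ R_{fbca} = ∇_c R_{ba} - ∇_a R_{bc}`. -/
theorem div_Rm (Y Z W : Vec A) : S.tr (S.nabla S.D4 S.Rm) Y Z W =
    S.nabla S.D2 S.Ric Z Y W - S.nabla S.D2 S.Ric W Y Z := by
  simp only [tr_eq, LinearMap.add_apply, nabla_Ric]
  linear_combination S.nabla_Rm_cyclic S.l S.n Y Z W + S.nabla_Rm_cyclic S.n S.l Y Z W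
    + S.nabla_Rm_cyclic S.p S.p Y Z W + S.nabla_Rm_cyclic S.q S.q Y Z W
    - S.nabla_Rm_antisymm_right Z S.l Y S.n W - S.nabla_Rm_antisymm_right Z S.n Y S.l W
    - S.nabla_Rm_antisymm_right Z S.p Y S.p W - S.nabla_Rm_antisymm_right Z S.q Y S.q W

theorem dir_scal (V : Vec A) : S.dir V S.scal = S.tr (S.nabla S.D2 S.Ric V) :=
  S.nabla_tr S.D0 S.Ric V

/-- The twice contracted Bianchi identity `2 ∇ᵃ R_{ac} = ∇_c R`. -/
theorem two_mul_div_Ric (Z : Vec A) : 2 * S.tr (S.nabla S.D2 S.Ric) Z = S.dir Z S.scal := by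
  have h1 := S.div_Rm S.l Z S.n
  have h2 := S.div_Rm S.n Z S.l
  have h3 := S.div_Rm S.p Z S.p
  have h4 := S.div_Rm S.q Z S.q
  have hf : ∀ V U, S.nabla S.D4 S.Rm V U S.l Z S.n + S.nabla S.D4 S.Rm V U S.n Z S.l
      + S.nabla S.D4 S.Rm V U S.p Z S.p + S.nabla S.D4 S.Rm V U S.q Z S.q
      = S.nabla S.D2 S.Ric V U Z := fun V U => by
    have e : ∀ P Q, S.nabla S.D4 S.Rm V U P Z Q = S.nabla S.D4 S.Rm V P U Q Z := fun P Q => by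
      rw [← S.nabla_Rm_pair_symm V U P Z Q, S.nabla_Rm_antisymm_right V Z Q P U,
        S.nabla_Rm_pair_symm V P U Z Q, S.nabla_Rm_antisymm_right V P U Q Z, neg_neg]
    rw [nabla_Ric]
    linear_combination e S.l S.n + e S.n S.l + e S.p S.p + e S.q S.q
  simp only [tr_eq, LinearMap.add_apply, dir_scal] at h1 h2 h3 h4 ⊢
  linear_combination h1 + h2 + h3 + h4 - hf S.l S.n - hf S.n S.l - hf S.p S.p - hf S.q S.q

end FrameMetric

/-! ### The Weyl and Bach tensors -/

namespace FrameMetric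

variable {A : Type*} [CommRing A] [Algebra ℝ A] (S : FrameMetric A)

/-- The Weyl tensor. -/
def W : Cov A (Cov A (Cov A (Cov A A))) :=
  ext1 fun a => ext1 fun b => ext1 fun c => ext1 fun d =>
    (∑ e, S.G a e * S.Rup e b c d)
      - algebraMap ℝ A (1 / 2) * (S.G a c * (∑ e, S.Rup e b e d) - S.G a d * (∑ e, S.Rup e b e c)
        - S.G b c * (∑ e, S.Rup e a e d) + S.G b d * (∑ e, S.Rup e a e c))
      + algebraMap ℝ A (1 / 6) * S.scal * (S.G a c * S.G b d - S.G a d * S.G b c)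

theorem W_eq (X Y Z U : Vec A) : S.W X Y Z U = S.Rm X Y Z U
    - algebraMap ℝ A (1 / 2) * (S.g X Z * S.Ric Y U - S.g X U * S.Ric Y Z
      - S.g Y Z * S.Ric X U + S.g Y U * S.Ric X Z)
    + algebraMap ℝ A (1 / 6) * S.scal * (S.g X Z * S.g Y U - S.g X U * S.g Y Z) := by
  rw [← sub_eq_zero]
  refine vec_induction (P := fun X => S.W X Y Z U - (S.Rm X Y Z U
    - algebraMap ℝ A (1 / 2) * (S.g X Z * S.Ric Y U - S.g X U * S.Ric Y Z
      - S.g Y Z * S.Ric X U + S.g Y U * S.Ric X Z)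
    + algebraMap ℝ A (1 / 6) * S.scal * (S.g X Z * S.g Y U - S.g X U * S.g Y Z)) = 0)
    (fun a => ?_) (fun X X' h h' => ?_) (fun f X h => ?_) X
  · refine trilin_ext (F := fun Y Z U => S.W (coordVec a) Y Z U - (S.Rm (coordVec a) Y Z U
      - algebraMap ℝ A (1 / 2) * (S.g (coordVec a) Z * S.Ric Y U - S.g (coordVec a) U * S.Ric Y Z
        - S.g Y Z * S.Ric (coordVec a) U + S.g Y U * S.Ric (coordVec a) Z)
      + algebraMap ℝ A (1 / 6) * S.scal * (S.g (coordVec a) Z * S.g Y U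
        - S.g (coordVec a) U * S.g Y Z))) ?_ ?_ ?_ ?_ ?_ ?_ (fun b c d => ?_) Y Z U
    any_goals
      intros
      simp only [map_add, map_smul, LinearMap.add_apply, LinearMap.smul_apply, smul_eq_mul]
      ring
    simp only [W, Rm, Ric, g, ext1_coordVec, sub_self]
  · simp only [map_add, LinearMap.add_apply]
    linear_combination h + h'
  · simp only [map_smul, LinearMap.smul_apply, smul_eq_mul]
    linear_combination f * h

theorem W_antisymm_left (X Y Z U : Vec A) : S.W Y X Z U = -S.W X Y Z U := by
  rw [W_eq, W_eq, S.Rm_antisymm_left X Y]; ring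

theorem W_antisymm_right (X Y Z U : Vec A) : S.W X Y U Z = -S.W X Y Z U := by
  rw [W_eq, W_eq, S.Rm_antisymm_right X Y]; ring

theorem W_pair_symm (X Y Z U : Vec A) : S.W Z U X Y = S.W X Y Z U := by
  rw [W_eq, W_eq, S.Rm_pair_symm X Y, S.g_symm X Z, S.g_symm Y U, S.g_symm X U, S.g_symm Y Z,
    S.Ric_symm X Z, S.Ric_symm Y U, S.Ric_symm X U, S.Ric_symm Y Z]
  ring

theorem W_cyclic (X Y Z U : Vec A) : S.W X Y Z U + S.W X Z U Y + S.W X U Y Z = 0 := by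
  simp only [W_eq]
  rw [S.g_symm U Y, S.g_symm Z Y, S.g_symm U Z, S.Ric_symm U Y, S.Ric_symm Z Y, S.Ric_symm U Z]
  linear_combination S.Rm_cyclic X Y Z U

theorem W_reverse (X Y Z U : Vec A) : S.W U Z Y X = S.W X Y Z U := by
  rw [← S.W_pair_symm, S.W_antisymm_left, S.W_antisymm_right, neg_neg]

/-- The Weyl tensor is trace free. -/
theorem W_trace (X Y : Vec A) :
    S.W S.l X S.n Y + S.W S.n X S.l Y + S.W S.p X S.p Y + S.W S.q X S.q Y = 0 := by
  have h2 : algebraMap ℝ A (1 / 2) + algebraMap ℝ A (1 / 2) = 1 := algebraMap_half_add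
  have hg : S.g X Y = S.g X S.l * S.g S.n Y + S.g X S.n * S.g S.l Y + S.g X S.p * S.g S.p Y
      + S.g X S.q * S.g S.q Y := by
    conv_lhs => rw [S.frame_expansion Y]
    simp only [map_add, map_smul, smul_eq_mul]; ring
  have hR : S.Ric X Y = S.g X S.l * S.Ric S.n Y + S.g X S.n * S.Ric S.l Y
      + S.g X S.p * S.Ric S.p Y + S.g X S.q * S.Ric S.q Y := by
    conv_lhs => rw [S.frame_expansion X]
    simp only [map_add, map_smul, smul_eq_mul, LinearMap.add_apply, LinearMap.smul_apply,
      S.g_symm X]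
    ring
  have hR' : S.Ric X Y = S.g S.l Y * S.Ric X S.n + S.g S.n Y * S.Ric X S.l
      + S.g S.p Y * S.Ric X S.p + S.g S.q Y * S.Ric X S.q := by
    conv_lhs => rw [S.frame_expansion Y]
    simp only [map_add, map_smul, smul_eq_mul]
    ring
  have hs : S.scal = S.Ric S.l S.n + S.Ric S.n S.l + S.Ric S.p S.p + S.Ric S.q S.q := S.tr_eq _
  have h36 : algebraMap ℝ A (1 / 2) = 3 * algebraMap ℝ A (1 / 6) := by
    rw [← map_ofNat (algebraMap ℝ A), ← map_mul]; norm_num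
  have h := S.Ric_eq X Y
  rw [S.g_symm X S.l, S.g_symm X S.n, S.g_symm X S.p, S.g_symm X S.q] at hg hR
  rw [S.Ric_symm X S.l, S.Ric_symm X S.n, S.Ric_symm X S.p, S.Ric_symm X S.q] at hR'
  simp only [W_eq, g_ln, g_nl, g_pp, g_qq]
  rw [S.g_symm X S.l, S.g_symm X S.n, S.g_symm X S.p, S.g_symm X S.q,
    S.Ric_symm X S.l, S.Ric_symm X S.n, S.Ric_symm X S.p, S.Ric_symm X S.q]
  linear_combination -h - algebraMap ℝ A (1 / 2) * hR' - algebraMap ℝ A (1 / 2) * hR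
    + algebraMap ℝ A (1 / 2) * S.g X Y * hs + algebraMap ℝ A (1 / 6) * S.scal * hg
    - S.Ric X Y * h2 - S.g X Y * S.scal * h36

/-- The covariant derivative of the Weyl tensor when the Ricci scalar is constant. -/
theorem nabla_W (hs : ∀ V, S.dir V S.scal = 0) (V X Y Z U : Vec A) :
    S.nabla S.D4 S.W V X Y Z U = S.nabla S.D4 S.Rm V X Y Z U
      - algebraMap ℝ A (1 / 2) * (S.g X Z * S.nabla S.D2 S.Ric V Y U
        - S.g X U * S.nabla S.D2 S.Ric V Y Z - S.g Y Z * S.nabla S.D2 S.Ric V X U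
        + S.g Y U * S.nabla S.D2 S.Ric V X Z) := by
  simp only [nabla_D4, nabla_D2, W_eq, dir_add, dir_sub, dir_mul, dir_algebraMap, dir_g, hs]
  ring

theorem div_Ric (hs : ∀ V, S.dir V S.scal = 0) (Z : Vec A) :
    S.tr (S.nabla S.D2 S.Ric) Z = 0 := by
  have h := S.two_mul_div_Ric Z
  rw [hs] at h
  linear_combination algebraMap ℝ A (1 / 2) * h
    - S.tr (S.nabla S.D2 S.Ric) Z * algebraMap_half_add (A := A)

/-- The divergence of the Weyl tensor when the Ricci scalar is constant. -/
theorem div_W (hs : ∀ V, S.dir V S.scal = 0) (Y Z U : Vec A) :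
    S.tr (S.nabla S.D4 S.W) Y Z U = algebraMap ℝ A (1 / 2) *
      (S.nabla S.D2 S.Ric Z Y U - S.nabla S.D2 S.Ric U Y Z) := by
  have h2 : algebraMap ℝ A (1 / 2) + algebraMap ℝ A (1 / 2) = 1 := algebraMap_half_add
  have hZ : ∀ Z Y U, S.nabla S.D2 S.Ric Z Y U = S.g S.n Z * S.nabla S.D2 S.Ric S.l Y U
      + S.g S.l Z * S.nabla S.D2 S.Ric S.n Y U + S.g S.p Z * S.nabla S.D2 S.Ric S.p Y U
      + S.g S.q Z * S.nabla S.D2 S.Ric S.q Y U := fun Z Y U => by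
    conv_lhs => rw [S.frame_expansion Z]
    simp only [map_add, map_smul, smul_eq_mul, LinearMap.add_apply, LinearMap.smul_apply]
  have hRm := S.div_Rm Y Z U
  have dZ := S.div_Ric hs Z
  have dU := S.div_Ric hs U
  have eZ := hZ Z Y U
  have eU := hZ U Y Z
  simp only [tr_eq, LinearMap.add_apply, nabla_W S hs] at hRm dZ dU ⊢
  linear_combination hRm + algebraMap ℝ A (1 / 2) * (eZ - eU + S.g Y Z * dU - S.g Y U * dZ)
    - (S.nabla S.D2 S.Ric Z Y U - S.nabla S.D2 S.Ric U Y Z) * h2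

/-- Traces of bilinear functions in the null frame. -/
theorem sum_H_eq {F : Vec A → Vec A → A} (h1 : ∀ X X' Y, F (X + X') Y = F X Y + F X' Y)
    (h1' : ∀ (f : A) X Y, F (f • X) Y = f * F X Y) (h2 : ∀ X Y Y', F X (Y + Y') = F X Y + F X Y')
    (h2' : ∀ (f : A) X Y, F X (f • Y) = f * F X Y) :
    ∑ a, ∑ b, S.H a b * F (coordVec a) (coordVec b) =
      F S.l S.n + F S.n S.l + F S.p S.p + F S.q S.q := by
  let T : Cov A (Cov A A) := LinearMap.mk₂ A F h1 h1' h2 h2'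
  exact S.tr_eq T

/-- The Bach tensor `∇ᶜ∇ᵈ C_{acbd} + ½ Rᶜᵈ C_{acbd}`, contracted with two vector fields. -/
def bach (X Y : Vec A) : A :=
  (∑ c, ∑ d, ∑ e, ∑ f, S.H c e * S.H d f * S.nabla S.D5 (S.nabla S.D4 S.W) (coordVec e)
      (coordVec f) X (coordVec c) Y (coordVec d))
    + algebraMap ℝ A (1 / 2) * ∑ c, ∑ d, (∑ a, ∑ b, S.H c a * S.H d b *
      S.Ric (coordVec a) (coordVec b)) * S.W X (coordVec c) Y (coordVec d)

theorem nabla_nabla_W_reverse (V V' X Y Z U : Vec A) :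
    S.nabla S.D5 (S.nabla S.D4 S.W) V V' U Z Y X =
      S.nabla S.D5 (S.nabla S.D4 S.W) V V' X Y Z U := by
  have h : ∀ V X Y Z U, S.nabla S.D4 S.W V U Z Y X = S.nabla S.D4 S.W V X Y Z U :=
    fun V X Y Z U => by
      simp only [nabla_D4]
      rw [S.W_reverse X Y Z U, S.W_reverse (S.DV V X) Y Z U, S.W_reverse X (S.DV V Y) Z U,
        S.W_reverse X Y (S.DV V Z) U, S.W_reverse X Y Z (S.DV V U)]
      ring
  rw [nabla_D5, nabla_D5, h V' X Y Z U, h V' (S.DV V X) Y Z U, h V' X (S.DV V Y) Z U,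
    h V' X Y (S.DV V Z) U, h V' X Y Z (S.DV V U), h (S.DV V V') X Y Z U]
  ring

/-- The divergence of the divergence of the Weyl tensor. -/
theorem nabla_div_W (hs : ∀ V, S.dir V S.scal = 0) (V Y Z U : Vec A) :
    S.tr (S.nabla S.D5 (S.nabla S.D4 S.W) V) Y Z U = algebraMap ℝ A (1 / 2) *
      (S.nabla S.D3 (S.nabla S.D2 S.Ric) V Z Y U
        - S.nabla S.D3 (S.nabla S.D2 S.Ric) V U Y Z) := by
  have h := congrArg (fun T => T Y Z U) (S.nabla_tr S.D3 (S.nabla S.D4 S.W) V)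
  rw [← h]
  simp only [nabla_D3, div_W S hs, dir_mul, dir_sub, dir_algebraMap]
  ring

end FrameMetric

namespace FrameMetric

variable {A : Type*} [CommRing A] [Algebra ℝ A] (S : FrameMetric A)

/-- The part `∇ᶜ∇ᵈ C_{acbd}` of the Bach tensor in terms of second derivatives of the Ricci
tensor. -/
theorem bach_eq (hs : ∀ V, S.dir V S.scal = 0) (X Y : Vec A) : S.bach X Y =
    algebraMap ℝ A (1 / 2) * (S.tr (S.nabla S.D3 (S.nabla S.D2 S.Ric)) Y X
      - (S.nabla S.D3 (S.nabla S.D2 S.Ric) S.l X Y S.n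
        + S.nabla S.D3 (S.nabla S.D2 S.Ric) S.n X Y S.l
        + S.nabla S.D3 (S.nabla S.D2 S.Ric) S.p X Y S.p
        + S.nabla S.D3 (S.nabla S.D2 S.Ric) S.q X Y S.q))
    + algebraMap ℝ A (1 / 2) * ∑ c, ∑ d, (∑ a, ∑ b, S.H c a * S.H d b *
      S.Ric (coordVec a) (coordVec b)) * S.W X (coordVec c) Y (coordVec d) := by
  rw [bach]
  congr 1
  have h1 : ∀ c e, ∑ d, ∑ f, S.H c e * S.H d f * S.nabla S.D5 (S.nabla S.D4 S.W) (coordVec e)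
      (coordVec f) X (coordVec c) Y (coordVec d) = S.H e c * (algebraMap ℝ A (1 / 2) *
        (S.nabla S.D3 (S.nabla S.D2 S.Ric) (coordVec e) (coordVec c) Y X
        - S.nabla S.D3 (S.nabla S.D2 S.Ric) (coordVec e) X Y (coordVec c))) := fun c e => by
    rw [← S.nabla_div_W hs, tr]
    simp only [LinearMap.sum_apply, LinearMap.smul_apply, smul_eq_mul, Finset.mul_sum]
    rw [Finset.sum_comm]
    refine Finset.sum_congr rfl fun f _ => Finset.sum_congr rfl fun d _ => ?_
    rw [nabla_nabla_W_reverse, S.H_symm c e, S.H_symm d f]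
    ring
  have h2 : ∀ c, ∑ d, ∑ e, ∑ f, S.H c e * S.H d f * S.nabla S.D5 (S.nabla S.D4 S.W) (coordVec e)
      (coordVec f) X (coordVec c) Y (coordVec d) = ∑ e, S.H e c * (algebraMap ℝ A (1 / 2) *
        (S.nabla S.D3 (S.nabla S.D2 S.Ric) (coordVec e) (coordVec c) Y X
        - S.nabla S.D3 (S.nabla S.D2 S.Ric) (coordVec e) X Y (coordVec c))) := fun c => by
    rw [Finset.sum_comm]
    exact Finset.sum_congr rfl fun e _ => h1 c e
  simp only [h2]
  rw [Finset.sum_comm, S.sum_H_eq (F := fun V U => algebraMap ℝ A (1 / 2) *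
        (S.nabla S.D3 (S.nabla S.D2 S.Ric) V U Y X
        - S.nabla S.D3 (S.nabla S.D2 S.Ric) V X Y U))]
  · simp only [tr_eq, LinearMap.add_apply]; ring
  all_goals
    intros
    simp only [map_add, map_smul, LinearMap.add_apply, LinearMap.smul_apply, smul_eq_mul]
    ring

/-- The contraction `Rᶜᵈ C_{acbd}` in the null frame. -/
theorem ricUp_W_eq (X Y : Vec A) : ∑ c, ∑ d, (∑ a, ∑ b, S.H c a * S.H d b *
      S.Ric (coordVec a) (coordVec b)) * S.W X (coordVec c) Y (coordVec d) =
    (S.Ric S.l S.l * S.W X S.n Y S.n + S.Ric S.l S.n * S.W X S.n Y S.l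
      + S.Ric S.l S.p * S.W X S.n Y S.p + S.Ric S.l S.q * S.W X S.n Y S.q)
    + (S.Ric S.n S.l * S.W X S.l Y S.n + S.Ric S.n S.n * S.W X S.l Y S.l
      + S.Ric S.n S.p * S.W X S.l Y S.p + S.Ric S.n S.q * S.W X S.l Y S.q)
    + (S.Ric S.p S.l * S.W X S.p Y S.n + S.Ric S.p S.n * S.W X S.p Y S.l
      + S.Ric S.p S.p * S.W X S.p Y S.p + S.Ric S.p S.q * S.W X S.p Y S.q)
    + (S.Ric S.q S.l * S.W X S.q Y S.n + S.Ric S.q S.n * S.W X S.q Y S.l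
      + S.Ric S.q S.p * S.W X S.q Y S.p + S.Ric S.q S.q * S.W X S.q Y S.q) := by
  have h1 : ∀ V U : Vec A, ∑ b, ∑ d, S.H b d * (S.Ric V (coordVec b) * S.W X U Y (coordVec d)) =
      S.Ric V S.l * S.W X U Y S.n + S.Ric V S.n * S.W X U Y S.l
      + S.Ric V S.p * S.W X U Y S.p + S.Ric V S.q * S.W X U Y S.q := fun V U => by
    refine S.sum_H_eq (F := fun P Q => S.Ric V P * S.W X U Y Q) ?_ ?_ ?_ ?_
    all_goals
      intros
      simp only [map_add, map_smul, smul_eq_mul]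
      ring
  have h2 := S.sum_H_eq (F := fun V U => S.Ric V S.l * S.W X U Y S.n + S.Ric V S.n * S.W X U Y S.l
      + S.Ric V S.p * S.W X U Y S.p + S.Ric V S.q * S.W X U Y S.q) ?_ ?_ ?_ ?_
  · have h3 : ∑ c, ∑ d, (∑ a, ∑ b, S.H c a * S.H d b *
        S.Ric (coordVec a) (coordVec b)) * S.W X (coordVec c) Y (coordVec d) =
        ∑ a, ∑ c, S.H a c * ∑ b, ∑ d, S.H b d *
          (S.Ric (coordVec a) (coordVec b) * S.W X (coordVec c) Y (coordVec d)) := by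
      rw [Finset.sum_comm (f := fun a c => S.H a c * _)]
      refine Finset.sum_congr rfl fun c _ => ?_
      simp only [Finset.mul_sum, Finset.sum_mul]
      rw [Finset.sum_comm]
      refine Finset.sum_congr rfl fun a _ => ?_
      rw [Finset.sum_comm]
      refine Finset.sum_congr rfl fun b _ => Finset.sum_congr rfl fun d _ => ?_
      rw [S.H_symm a c, S.H_symm b d]
      ring
    rw [h3]
    simp only [h1]
    exact h2
  all_goals
    intros
    simp only [map_add, map_smul, LinearMap.add_apply, LinearMap.smul_apply, smul_eq_mul]
    ring

/-! ### Ricci tensors of traceless type III and aligned Weyl tensors of type II -/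

/-- The Ricci tensor is `Λ g_{ab} + ψ_i (ℓ_a m⁽ⁱ⁾_b + m⁽ⁱ⁾_a ℓ_b) + w ℓ_a ℓ_b`. -/
def RicTypeIII (Λ : ℝ) (ψ χ w : A) : Prop := ∀ X Y, S.Ric X Y = algebraMap ℝ A Λ * S.g X Y
  + ψ * (S.g S.l X * S.g S.p Y + S.g S.p X * S.g S.l Y)
  + χ * (S.g S.l X * S.g S.q Y + S.g S.q X * S.g S.l Y) + w * S.g S.l X * S.g S.l Y

/-- The frame vectors in the order `ℓ, n, p, q`. -/
def frame : Fin 4 → Vec A := ![S.l, S.n, S.p, S.q]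

/-- The frame components of positive boost weight of the Weyl tensor vanish. -/
def WAligned : Prop := ∀ a b c d : Fin 4,
  0 < boostWeight a + boostWeight b + boostWeight c + boostWeight d →
    S.W (S.frame a) (S.frame b) (S.frame c) (S.frame d) = 0

variable {S} {Λ : ℝ} {ψ χ w : A}

theorem RicTypeIII.scal_eq (h : S.RicTypeIII Λ ψ χ w) : S.scal = algebraMap ℝ A (4 * Λ) := by
  rw [scal, tr_eq, h, h, h, h]
  simp only [g_ll, g_ln, g_lp, g_lq, g_pp, g_pq, g_qq, g_nl, g_pl, g_ql, g_pn, g_qn, g_qp, map_mul,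
    map_ofNat]
  ring

theorem RicTypeIII.dir_scal (h : S.RicTypeIII Λ ψ χ w) (V : Vec A) : S.dir V S.scal = 0 := by
  rw [h.scal_eq, dir_algebraMap]

theorem RicTypeIII.ric_l (h : S.RicTypeIII Λ ψ χ w) (X : Vec A) :
    S.Ric X S.l = algebraMap ℝ A Λ * S.g S.l X := by
  rw [h]
  simp only [g_ll, g_pl, g_ql, S.g_symm X]
  ring

theorem RicTypeIII.ric_p (h : S.RicTypeIII Λ ψ χ w) (X : Vec A) :
    S.Ric X S.p = algebraMap ℝ A Λ * S.g S.p X + ψ * S.g S.l X := by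
  rw [h]
  simp only [g_lp, g_pp, g_qp, S.g_symm X]
  ring

theorem RicTypeIII.ric_q (h : S.RicTypeIII Λ ψ χ w) (X : Vec A) :
    S.Ric X S.q = algebraMap ℝ A Λ * S.g S.q X + χ * S.g S.l X := by
  rw [h]
  simp only [g_lq, g_pq, g_qq, S.g_symm X]
  ring

theorem RicTypeIII.nabla_ric_l (h : S.RicTypeIII Λ ψ χ w) (V Y : Vec A) :
    S.nabla S.D2 S.Ric V Y S.l =
      -(ψ * S.g S.p (S.DV V S.l) + χ * S.g S.q (S.DV V S.l)) * S.g S.l Y := by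
  have e : S.g S.l (S.DV V S.l) = 0 := by
    rw [S.DV_l]
    simp only [map_add, map_smul, g_ll, g_lp, g_lq, smul_eq_mul]
    ring
  rw [nabla_D2, h.ric_l, h.ric_l, h, dir_mul, dir_algebraMap, dir_g, S.g_symm Y, e]
  ring

theorem RicTypeIII.nabla_ric_pp (h : S.RicTypeIII Λ ψ χ w) (V : Vec A) :
    S.nabla S.D2 S.Ric V S.p S.p = 2 * ψ * S.g S.p (S.DV V S.l) := by
  rw [nabla_D2, h.ric_p, S.Ric_symm, h.ric_p, g_pp, g_lp, S.DV_p]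
  simp only [dir_add, dir_mul, dir_algebraMap, dir_zero, dir_one, map_add, map_sub, map_smul,
    smul_eq_mul, g_ll, g_ln, g_lq, g_pl, g_pn, g_pq]
  ring

theorem RicTypeIII.nabla_ric_qq (h : S.RicTypeIII Λ ψ χ w) (V : Vec A) :
    S.nabla S.D2 S.Ric V S.q S.q = 2 * χ * S.g S.q (S.DV V S.l) := by
  rw [nabla_D2, h.ric_q, S.Ric_symm, h.ric_q, g_qq, g_lq, S.DV_q]
  simp only [dir_add, dir_mul, dir_algebraMap, dir_zero, dir_one, map_sub, map_smul,
    smul_eq_mul, g_ll, g_lp, g_ln, g_ql, g_qn, g_qp]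
  ring

theorem RicTypeIII.nabla_ric_pq (h : S.RicTypeIII Λ ψ χ w) (V : Vec A) :
    S.nabla S.D2 S.Ric V S.p S.q =
      ψ * S.g S.q (S.DV V S.l) + χ * S.g S.p (S.DV V S.l) := by
  rw [nabla_D2, h.ric_q, h.ric_q, S.Ric_symm, h.ric_p, g_qp, g_lp, S.DV_p, S.DV_q]
  simp only [dir_add, dir_mul, dir_algebraMap, dir_zero, map_add, map_sub, map_smul,
    smul_eq_mul, g_ll, g_lp, g_ln, g_lq, g_ql, g_qn, g_pl, g_pn, g_pp, g_qq]
  ring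

/-- The inner product `g^{ce} (m⁽ⁱ⁾ ∇_c ℓ) (m⁽ʲ⁾ ∇_e ℓ)`, for `m⁽ⁱ⁾, m⁽ʲ⁾ = X, Y`; it is
`(ρ ρᵀ)_{ij}` if `ℓ` is geodetic. -/
def opt (S : FrameMetric A) (X Y : Vec A) : A :=
  S.g X (S.DV S.l S.l) * S.g Y (S.DV S.n S.l) + S.g X (S.DV S.n S.l) * S.g Y (S.DV S.l S.l)
    + S.g X (S.DV S.p S.l) * S.g Y (S.DV S.p S.l) + S.g X (S.DV S.q S.l) * S.g Y (S.DV S.q S.l)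

/-- The component `(□ Ric)(m⁽²⁾, ℓ)` of the d'Alembertian of the Ricci tensor. -/
theorem RicTypeIII.box_p (h : S.RicTypeIII Λ ψ χ w) :
    S.tr (S.nabla S.D3 (S.nabla S.D2 S.Ric)) S.p S.l =
      -((3 * S.opt S.p S.p + S.opt S.q S.q) * ψ + 2 * S.opt S.p S.q * χ) := by
  have key : ∀ V U, S.nabla S.D3 (S.nabla S.D2 S.Ric) V U S.p S.l =
      -(2 * ψ * S.g S.p (S.DV V S.l) * S.g S.p (S.DV U S.l) + S.g S.q (S.DV V S.l) *
        (ψ * S.g S.q (S.DV U S.l) + χ * S.g S.p (S.DV U S.l))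
      + (ψ * S.g S.p (S.DV U S.l) + χ * S.g S.q (S.DV U S.l)) * S.g S.p (S.DV V S.l)) :=
    fun V U => by
    rw [nabla_D3, h.nabla_ric_l, h.nabla_ric_l, h.nabla_ric_l, S.DV_l V, S.DV_p V]
    simp only [map_add, map_sub, map_smul, smul_eq_mul, h.nabla_ric_l, h.nabla_ric_pp,
      h.nabla_ric_pq, g_ll, g_lp, g_ln, g_lq, g_pl, g_pp, g_pq, g_ql, g_qp, g_qq, dir_zero,
      mul_zero]
    ring
  rw [tr_eq]
  simp only [LinearMap.add_apply, key, opt]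
  ring

/-- The component `(□ Ric)(m⁽³⁾, ℓ)` of the d'Alembertian of the Ricci tensor. -/
theorem RicTypeIII.box_q (h : S.RicTypeIII Λ ψ χ w) :
    S.tr (S.nabla S.D3 (S.nabla S.D2 S.Ric)) S.q S.l =
      -((3 * S.opt S.q S.q + S.opt S.p S.p) * χ + 2 * S.opt S.p S.q * ψ) := by
  have key : ∀ V U, S.nabla S.D3 (S.nabla S.D2 S.Ric) V U S.q S.l =
      -(2 * χ * S.g S.q (S.DV V S.l) * S.g S.q (S.DV U S.l) + S.g S.p (S.DV V S.l) *
        (ψ * S.g S.q (S.DV U S.l) + χ * S.g S.p (S.DV U S.l))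
      + (ψ * S.g S.p (S.DV U S.l) + χ * S.g S.q (S.DV U S.l)) * S.g S.q (S.DV V S.l)) :=
    fun V U => by
    rw [nabla_D3, h.nabla_ric_l, h.nabla_ric_l, h.nabla_ric_l, S.DV_l V, S.DV_q V]
    simp only [map_add, map_sub, map_smul, smul_eq_mul, h.nabla_ric_l, h.nabla_ric_qq,
      S.nabla_Ric_symm U S.q S.p,
      h.nabla_ric_pq, g_ll, g_lp, g_ln, g_lq, g_pl, g_pp, g_pq, g_ql, g_qp, g_qq, dir_zero,
      mul_zero]
    ring
  rw [tr_eq]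
  simp only [LinearMap.add_apply, key, opt]
  ring

end FrameMetric

/-! ### The Bach tensor as the d'Alembertian of the Ricci tensor -/

namespace FrameMetric

variable {A : Type*} [CommRing A] [Algebra ℝ A] {S : FrameMetric A} {Λ : ℝ} {ψ χ w : A}

theorem eq_zero_of_eq_neg {x : A} (h : x = -x) : x = 0 := by
  linear_combination algebraMap ℝ A (1 / 2) * h - x * algebraMap_half_add (A := A)

theorem W_self_left (X Z U : Vec A) : S.W X X Z U = 0 :=
  eq_zero_of_eq_neg (S.W_antisymm_left X X Z U)

theorem W_self_right (X Z U : Vec A) : S.W Z U X X = 0 :=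
  eq_zero_of_eq_neg (S.W_antisymm_right Z U X X)

theorem Rm_self_right (X Z U : Vec A) : S.Rm Z U X X = 0 :=
  eq_zero_of_eq_neg (S.Rm_antisymm_right Z U X X)

theorem Rm_self_left (X Z U : Vec A) : S.Rm X X Z U = 0 :=
  eq_zero_of_eq_neg (S.Rm_antisymm_left X X Z U)

theorem nabla_nabla_Ric_symm (V U X Y : Vec A) :
    S.nabla S.D3 (S.nabla S.D2 S.Ric) V U X Y = S.nabla S.D3 (S.nabla S.D2 S.Ric) V U Y X := by
  rw [nabla_D3, nabla_D3, S.nabla_Ric_symm U X Y, S.nabla_Ric_symm U X, S.nabla_Ric_symm U _ Y,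
    S.nabla_Ric_symm (S.DV V U) X Y]
  ring

/-- On components `(ℓ, m)` with `m` spacelike in the frame, only the d'Alembertian of the Ricci
tensor contributes to the Bach tensor: all commutator and curvature terms have too low a boost
weight. -/
theorem RicTypeIII.bach_eq_box (h : S.RicTypeIII Λ ψ χ w) {m : Vec A} {k : A}
    (hm : S.g S.l m = 0)
    (hk : ∀ X, S.Ric m X = algebraMap ℝ A Λ * S.g m X + k * S.g S.l X)
    (hn : S.W S.l S.n m S.l = 0) (hp : S.W S.l S.p m S.l = 0) (hq : S.W S.l S.q m S.l = 0)
    (hpp : S.W S.l S.p m S.p = 0) (hqq : S.W S.l S.q m S.q = 0) :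
    S.bach S.l m = algebraMap ℝ A (1 / 2) * S.tr (S.nabla S.D3 (S.nabla S.D2 S.Ric)) m S.l := by
  have hml : S.Ric m S.l = 0 := by rw [h.ric_l, hm, mul_zero]
  have hll : S.Ric S.l S.l = 0 := by rw [h.ric_l, g_ll, mul_zero]
  have hlp : S.Ric S.l S.p = 0 := by rw [h.ric_p, g_pl, g_ll]; ring
  have hlq : S.Ric S.l S.q = 0 := by rw [h.ric_q, g_ql, g_ll]; ring
  have hpq : S.Ric S.p S.q = 0 := by rw [h.ric_q, g_qp, g_lp]; ring
  have hm' : S.g m S.l = 0 := by rw [S.g_symm, hm]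
  have hRp : S.Rm S.l m S.p S.l = 0 := by
    have e := S.W_eq S.l m S.p S.l
    rw [← S.W_pair_symm, S.W_antisymm_left, S.W_antisymm_right, hp, hml, hll, hlp, hm', g_lp,
      g_ll] at e
    linear_combination -e
  have hRq : S.Rm S.l m S.q S.l = 0 := by
    have e := S.W_eq S.l m S.q S.l
    rw [← S.W_pair_symm, S.W_antisymm_left, S.W_antisymm_right, hq, hml, hll, hlq, hm', g_lq,
      g_ll] at e
    linear_combination -e
  -- The divergence of the Ricci tensor vanishes, hence so does its derivative.
  have hdiv : S.tr (S.nabla S.D3 (S.nabla S.D2 S.Ric) S.l) m = 0 := by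
    have e : S.tr (S.nabla S.D2 S.Ric) = 0 := LinearMap.ext fun Z => S.div_Ric h.dir_scal Z
    have e' := congrArg (fun T => T m) (S.nabla_tr S.D1 (S.nabla S.D2 S.Ric) S.l)
    rw [← e', e]
    simp [nabla_apply]
  have hcomm : ∀ V U, S.nabla S.D3 (S.nabla S.D2 S.Ric) V S.l m U =
      S.nabla S.D3 (S.nabla S.D2 S.Ric) S.l V U m - S.Ric (S.Rv V S.l m) U
        - S.Ric m (S.Rv V S.l U) := fun V U => by
    have e := S.ricci_identity S.Ric V S.l m U
    rw [nabla_nabla_Ric_symm S.l V m U] at e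
    linear_combination e
  rw [bach_eq S h.dir_scal, ricUp_W_eq]
  simp only [hcomm, hll, hlp, hlq, hpq, S.Ric_symm S.p S.l, S.Ric_symm S.q S.l,
    S.Ric_symm S.q S.p, W_self_left, hn, hp, hq, hpp, hqq]
  simp only [tr_eq, LinearMap.add_apply] at hdiv
  have r := fun V X Y U => S.g_Rv (A := A) V X Y U
  have c2 := S.Ric_eq S.l S.l
  rw [hll] at c2
  have cn : S.Ric (S.Rv S.l S.l m) S.n = algebraMap ℝ A Λ * S.Rm S.n m S.l S.l
    + ψ * S.Rm S.p m S.l S.l + χ * S.Rm S.q m S.l S.l + w * S.Rm S.l m S.l S.l := by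
    rw [h]
    simp only [S.g_symm (S.Rv S.l S.l m) S.n, r, g_ln, g_pn, g_qn]
    ring
  rw [cn, h.ric_l, h.ric_p, h.ric_q]
  simp only [hk, r, Rm_self_right, hRp, hRq]
  linear_combination -algebraMap ℝ A (1 / 2) * hdiv + algebraMap ℝ A (1 / 2) *
    (algebraMap ℝ A Λ * (S.Rm_antisymm_left S.l m S.n S.l + S.Rm_antisymm_left S.p m S.p S.l
      + S.Rm_antisymm_left S.q m S.q S.l) + k * (S.Rm_antisymm_left S.p S.l S.p S.l
      + S.Rm_antisymm_left S.q S.l S.q S.l + c2 + 2 * Rm_self_left (S := S) S.l S.n S.l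
      + Rm_self_right (S := S) S.l S.n S.l))

end FrameMetric

/-! ### Geodeticity and the optical matrix -/

namespace FrameMetric

variable {A : Type*} [CommRing A] [Algebra ℝ A] {S : FrameMetric A} {Λ : ℝ} {ψ χ w : A}

/-- The frame components of an aligned Weyl tensor of type II that the argument uses. -/
structure WTypeII (S : FrameMetric A) : Prop where
  lp_lp : S.W S.l S.p S.l S.p = 0
  lp_lq : S.W S.l S.p S.l S.q = 0
  lq_lq : S.W S.l S.q S.l S.q = 0
  ln_lp : S.W S.l S.n S.l S.p = 0
  ln_lq : S.W S.l S.n S.l S.q = 0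
  lp_pq : S.W S.l S.p S.p S.q = 0
  lq_pq : S.W S.l S.q S.p S.q = 0

theorem WAligned.typeII (h : S.WAligned) : WTypeII S where
  lp_lp := h 0 2 0 2 (by simp [boostWeight])
  lp_lq := h 0 2 0 3 (by simp [boostWeight])
  lq_lq := h 0 3 0 3 (by simp [boostWeight])
  ln_lp := h 0 1 0 2 (by simp [boostWeight])
  ln_lq := h 0 1 0 3 (by simp [boostWeight])
  lp_pq := h 0 2 2 3 (by simp [boostWeight])
  lq_pq := h 0 3 2 3 (by simp [boostWeight])

theorem trace_ln : S.W S.l S.n S.l S.n = S.W S.l S.p S.n S.p + S.W S.l S.q S.n S.q := by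
  have h := S.W_trace S.l S.n
  rw [W_self_left, S.W_antisymm_left S.l S.n, S.W_antisymm_left S.l S.p,
    S.W_antisymm_right S.l S.p S.n, S.W_antisymm_left S.l S.q, S.W_antisymm_right S.l S.q S.n] at h
  linear_combination -h

theorem trace_pp_qq : S.W S.l S.q S.n S.q = S.W S.l S.p S.n S.p := by
  have h := S.W_trace S.p S.p
  have h' := S.W_trace S.q S.q
  rw [W_self_left, ← S.W_pair_symm S.n S.p] at h
  rw [W_self_left, ← S.W_pair_symm S.n S.q] at h'
  rw [S.W_antisymm_left S.p S.q, S.W_antisymm_right S.p S.q] at h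
  linear_combination algebraMap ℝ A (1 / 2) * (h' - h) + (S.W S.l S.p S.n S.p
    - S.W S.l S.q S.n S.q) * algebraMap_half_add (A := A)

theorem trace_pp : S.W S.p S.q S.p S.q = -2 * S.W S.l S.p S.n S.p := by
  have h := S.W_trace S.p S.p
  rw [W_self_left, ← S.W_pair_symm S.n S.p, S.W_antisymm_left S.p S.q,
    S.W_antisymm_right S.p S.q] at h
  linear_combination h

theorem trace_pq : S.W S.l S.q S.n S.p = -S.W S.l S.p S.n S.q := by
  have h := S.W_trace S.p S.q
  rw [W_self_left, W_self_right, ← S.W_pair_symm S.n S.p] at h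
  linear_combination h

theorem cyclic_pq : S.W S.l S.n S.p S.q = 2 * S.W S.l S.p S.n S.q := by
  have h := S.W_cyclic S.l S.n S.p S.q
  rw [S.W_antisymm_right S.l S.p S.n, trace_pq] at h
  linear_combination h

theorem trace_np : S.W S.n S.q S.p S.q = -S.W S.l S.n S.n S.p := by
  have h := S.W_trace S.n S.p
  rw [W_self_left, W_self_right, S.W_antisymm_left S.n S.q, S.W_antisymm_right S.n S.q] at h
  linear_combination h

theorem trace_nq : S.W S.n S.p S.p S.q = S.W S.l S.n S.n S.q := by
  have h := S.W_trace S.n S.q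
  rw [W_self_left, W_self_right, S.W_antisymm_left S.n S.p] at h
  linear_combination -h

/-- The derivatives of the frame vectors, with the connection coefficients as opaque functions. -/
theorem exists_connection (S : FrameMetric A) : ∃ t a b c d r : Vec A → A,
    (∀ V, S.g S.p (S.DV V S.l) = a V) ∧ (∀ V, S.g S.q (S.DV V S.l) = b V) ∧
    (∀ V, S.DV V S.l = t V • S.l + a V • S.p + b V • S.q) ∧
    (∀ V, S.DV V S.n = -t V • S.n + c V • S.p + d V • S.q) ∧
    (∀ V, S.DV V S.p = -c V • S.l - a V • S.n + r V • S.q) ∧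
    (∀ V, S.DV V S.q = -d V • S.l - b V • S.n - r V • S.p) :=
  ⟨fun V => S.g S.n (S.DV V S.l), fun V => S.g S.p (S.DV V S.l), fun V => S.g S.q (S.DV V S.l),
    fun V => S.g S.p (S.DV V S.n), fun V => S.g S.q (S.DV V S.n), fun V => S.g S.q (S.DV V S.p),
    fun _ => rfl, fun _ => rfl, S.DV_l, S.DV_n, S.DV_p, S.DV_q⟩

set_option linter.unusedSimpArgs false in
/-- The components `∇ᶠ C_{fbca}` of positive boost weight. -/
theorem WTypeII.div_W_frame (hW : WTypeII S) {t a b c d r : Vec A → A}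
    (hl : ∀ V, S.DV V S.l = t V • S.l + a V • S.p + b V • S.q)
    (hn : ∀ V, S.DV V S.n = -t V • S.n + c V • S.p + d V • S.q)
    (hp : ∀ V, S.DV V S.p = -c V • S.l - a V • S.n + r V • S.q)
    (hq : ∀ V, S.DV V S.q = -d V • S.l - b V • S.n - r V • S.p) :
    S.tr (S.nabla S.D4 S.W) S.l S.p S.l = 3 * (S.W S.l S.p S.n S.p * a S.l
      + S.W S.l S.p S.n S.q * b S.l) ∧
    S.tr (S.nabla S.D4 S.W) S.l S.q S.l = 3 * (S.W S.l S.p S.n S.p * b S.l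
      - S.W S.l S.p S.n S.q * a S.l) ∧
    S.tr (S.nabla S.D4 S.W) S.p S.l S.p - S.tr (S.nabla S.D4 S.W) S.q S.l S.q =
      3 * (S.W S.l S.p S.n S.p * (b S.q - a S.p) - S.W S.l S.p S.n S.q * (b S.p + a S.q)) ∧
    S.tr (S.nabla S.D4 S.W) S.p S.l S.q + S.tr (S.nabla S.D4 S.W) S.q S.l S.p =
      3 * (S.W S.l S.p S.n S.q * (a S.p - b S.q) - S.W S.l S.p S.n S.p * (b S.p + a S.q)) := by
  refine ⟨?_, ?_, ?_, ?_⟩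
  all_goals
    rw [tr_eq]
    try rw [tr_eq]
    simp only [LinearMap.add_apply]
    simp only [map_add, map_sub, map_smul, LinearMap.add_apply, LinearMap.sub_apply,
      LinearMap.smul_apply, smul_eq_mul, W_self_left, W_self_right, S.W_antisymm_left S.l S.n,
      S.W_antisymm_left S.l S.p, S.W_antisymm_left S.l S.q, S.W_antisymm_left S.n S.p,
      S.W_antisymm_left S.n S.q, S.W_antisymm_left S.p S.q, S.W_antisymm_right _ _ S.l S.n,
      S.W_antisymm_right _ _ S.l S.p, S.W_antisymm_right _ _ S.l S.q,
      S.W_antisymm_right _ _ S.n S.p, S.W_antisymm_right _ _ S.n S.q,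
      S.W_antisymm_right _ _ S.p S.q,
      S.W_pair_symm S.l S.n S.l S.p, S.W_pair_symm S.l S.n S.l S.q, S.W_pair_symm S.l S.n S.n S.p,
      S.W_pair_symm S.l S.n S.n S.q, S.W_pair_symm S.l S.n S.p S.q, S.W_pair_symm S.l S.p S.l S.q,
      S.W_pair_symm S.l S.p S.n S.p, S.W_pair_symm S.l S.p S.n S.q, S.W_pair_symm S.l S.p S.p S.q,
      S.W_pair_symm S.l S.q S.n S.p, S.W_pair_symm S.l S.q S.n S.q, S.W_pair_symm S.l S.q S.p S.q,
      S.W_pair_symm S.n S.p S.n S.q, S.W_pair_symm S.n S.p S.p S.q, S.W_pair_symm S.n S.q S.p S.q,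
      hW.lp_lp, hW.lp_lq, hW.lq_lq, hW.ln_lp, hW.ln_lq, hW.lp_pq, hW.lq_pq, trace_ln, trace_pp,
      trace_pp_qq, trace_pq, cyclic_pq, trace_np, trace_nq, dir_neg, dir_zero, nabla_D4, hl,
      hn, hp, hq]
    ring

/-- The component `(ℓ, m⁽²⁾)` of the Bach tensor. -/
theorem RicTypeIII.bach_lp (h : S.RicTypeIII Λ ψ χ w) (hW : S.WAligned) :
    S.bach S.l S.p = -(algebraMap ℝ A (1 / 2) *
      ((3 * S.opt S.p S.p + S.opt S.q S.q) * ψ + 2 * S.opt S.p S.q * χ)) := by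
  rw [h.bach_eq_box S.g_lp (k := ψ) (fun X => by rw [S.Ric_symm, h.ric_p])
    (hW 0 1 2 0 (by simp [boostWeight])) (hW 0 2 2 0 (by simp [boostWeight]))
    (hW 0 3 2 0 (by simp [boostWeight])) (hW 0 2 2 2 (by simp [boostWeight]))
    (hW 0 3 2 3 (by simp [boostWeight])), h.box_p]
  ring

/-- The component `(ℓ, m⁽³⁾)` of the Bach tensor. -/
theorem RicTypeIII.bach_lq (h : S.RicTypeIII Λ ψ χ w) (hW : S.WAligned) :
    S.bach S.l S.q = -(algebraMap ℝ A (1 / 2) *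
      ((3 * S.opt S.q S.q + S.opt S.p S.p) * χ + 2 * S.opt S.p S.q * ψ)) := by
  rw [h.bach_eq_box S.g_lq (k := χ) (fun X => by rw [S.Ric_symm, h.ric_q])
    (hW 0 1 3 0 (by simp [boostWeight])) (hW 0 2 3 0 (by simp [boostWeight]))
    (hW 0 3 3 0 (by simp [boostWeight])) (hW 0 2 3 2 (by simp [boostWeight]))
    (hW 0 3 3 3 (by simp [boostWeight])), h.box_q]
  ring

/-- The Bianchi identities force `ℓ` to be geodetic. In complex notation, two of their components
say that `κ Ψ₂ = 0`; once `Ψ₂ = 0`, two others say that `κ` times `ψ` vanishes. -/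
theorem RicTypeIII.geodetic (h : S.RicTypeIII Λ ψ χ w) (hW : S.WAligned) (φ : A →ₐ[ℝ] ℝ)
    (hψ : φ ψ * φ ψ + φ χ * φ χ ≠ 0) :
    φ (S.g S.p (S.DV S.l S.l)) = 0 ∧ φ (S.g S.q (S.DV S.l S.l)) = 0 := by
  obtain ⟨t, a, b, c, d, r, ha, hb, hl, hn, hp, hq⟩ := exists_connection S
  obtain ⟨e1, e2, e3, e4⟩ := hW.typeII.div_W_frame hl hn hp hq
  rw [S.div_W h.dir_scal, h.nabla_ric_l, S.nabla_Ric_symm S.l S.l, h.nabla_ric_l, g_ll, g_lp] at e1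
  rw [S.div_W h.dir_scal, h.nabla_ric_l, S.nabla_Ric_symm S.l S.l, h.nabla_ric_l, g_ll, g_lq] at e2
  rw [S.div_W h.dir_scal, S.div_W h.dir_scal, h.nabla_ric_pp, h.nabla_ric_qq, h.nabla_ric_l,
    h.nabla_ric_l, g_lp, g_lq] at e3
  rw [S.div_W h.dir_scal, S.div_W h.dir_scal, S.nabla_Ric_symm S.l S.q S.p, h.nabla_ric_pq,
    h.nabla_ric_l, h.nabla_ric_l, g_lp, g_lq] at e4
  simp only [ha, hb] at e1 e2 e3 e4 ⊢
  have f1 := congrArg φ e1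
  have f2 := congrArg φ e2
  have f3 := congrArg φ e3
  have f4 := congrArg φ e4
  simp only [map_add, map_sub, map_mul, map_neg, map_zero, map_ofNat, AlgHom.commutes,
    Algebra.algebraMap_self, RingHom.id_apply] at f1 f2 f3 f4
  generalize φ (S.W S.l S.p S.n S.p) = P at *
  generalize φ (S.W S.l S.p S.n S.q) = Q at *
  generalize φ (a S.l) = x at *
  generalize φ (b S.l) = y at *
  -- `P` and `Q` are the real and imaginary parts of `Ψ₂`, up to factors, and `κ = x + iy`.
  by_cases hPQ : P * P + Q * Q = 0
  · have hP : P = 0 := by nlinarith [mul_self_nonneg P, mul_self_nonneg Q]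
    have hQ : Q = 0 := by nlinarith [mul_self_nonneg P, mul_self_nonneg Q]
    subst hP hQ
    have g3 : φ ψ * x - φ χ * y = 0 := by linear_combination f3
    have g4 : φ ψ * y + φ χ * x = 0 := by linear_combination f4
    constructor
    · refine (mul_eq_zero.mp ?_).resolve_left hψ
      linear_combination φ ψ * g3 + φ χ * g4
    · refine (mul_eq_zero.mp ?_).resolve_left hψ
      linear_combination φ ψ * g4 - φ χ * g3
  · constructor
    · refine (mul_eq_zero.mp ?_).resolve_left hPQ
      linear_combination -1 / 3 * P * f1 + 1 / 3 * Q * f2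
    · refine (mul_eq_zero.mp ?_).resolve_left hPQ
      linear_combination -1 / 3 * P * f2 - 1 / 3 * Q * f1

/-- If the components `(ℓ, m⁽ⁱ⁾)` of the Bach tensor vanish, the optical matrix `ρ` vanishes: the
contraction of these components with `ψ` is a multiple of `|ρ|² |ψ|² + 2 |ρᵀ ψ|²`. -/
theorem RicTypeIII.optical (h : S.RicTypeIII Λ ψ χ w) (hW : S.WAligned) (φ : A →ₐ[ℝ] ℝ)
    (hψ : φ ψ * φ ψ + φ χ * φ χ ≠ 0) (hp : φ (S.bach S.l S.p) = 0)
    (hq : φ (S.bach S.l S.q) = 0) :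
    φ (S.g S.p (S.DV S.p S.l)) = 0 ∧ φ (S.g S.p (S.DV S.q S.l)) = 0 ∧
    φ (S.g S.q (S.DV S.p S.l)) = 0 ∧ φ (S.g S.q (S.DV S.q S.l)) = 0 := by
  obtain ⟨k1, k2⟩ := h.geodetic hW φ hψ
  rw [h.bach_lp hW] at hp
  rw [h.bach_lq hW] at hq
  simp only [opt, map_add, map_mul, map_neg, map_ofNat, AlgHom.commutes, k1, k2,
    Algebra.algebraMap_self, RingHom.id_apply] at hp hq
  generalize φ (S.g S.p (S.DV S.p S.l)) = a at *
  generalize φ (S.g S.p (S.DV S.q S.l)) = b at *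
  generalize φ (S.g S.q (S.DV S.p S.l)) = c at *
  generalize φ (S.g S.q (S.DV S.q S.l)) = d at *
  have key : (a * a + b * b + c * c + d * d) * (φ ψ * φ ψ + φ χ * φ χ)
      + 2 * ((a * φ ψ + c * φ χ) * (a * φ ψ + c * φ χ)
        + (b * φ ψ + d * φ χ) * (b * φ ψ + d * φ χ)) = 0 := by
    linear_combination -2 * φ ψ * hp - 2 * φ χ * hq
  have hpos : 0 < φ ψ * φ ψ + φ χ * φ χ :=
    lt_of_le_of_ne (add_nonneg (mul_self_nonneg _) (mul_self_nonneg _)) (Ne.symm hψ)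
  have hle : (a * a + b * b + c * c + d * d) * (φ ψ * φ ψ + φ χ * φ χ) ≤ 0 := by
    linarith [mul_self_nonneg (a * φ ψ + c * φ χ), mul_self_nonneg (b * φ ψ + d * φ χ)]
  have hz : a * a + b * b + c * c + d * d ≤ 0 := nonpos_of_mul_nonpos_left hle hpos
  refine ⟨?_, ?_, ?_, ?_⟩ <;>
    nlinarith [mul_self_nonneg a, mul_self_nonneg b, mul_self_nonneg c, mul_self_nonneg d]

end FrameMetric

/-! ### Covariant derivatives and contractions in components -/

/-- Bilinear functions in components. -/
theorem bilin_eq_sum {A : Type*} [CommRing A] {F : Vec A → Vec A → A}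
    (h1 : ∀ X X' Y, F (X + X') Y = F X Y + F X' Y)
    (h1' : ∀ (f : A) X Y, F (f • X) Y = f * F X Y) (h2 : ∀ X Y Y', F X (Y + Y') = F X Y + F X Y')
    (h2' : ∀ (f : A) X Y, F X (f • Y) = f * F X Y) (X Y : Vec A) :
    F X Y = ∑ a, ∑ b, X a * Y b * F (coordVec a) (coordVec b) := by
  let T : Cov A (Cov A A) := LinearMap.mk₂ A F h1 h1' h2 h2'
  change T X Y = ∑ a, ∑ b, X a * Y b * T (coordVec a) (coordVec b)
  conv_lhs => rw [eq_sum_coordVec X, eq_sum_coordVec Y]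
  simp only [map_sum, map_smul, LinearMap.sum_apply, LinearMap.smul_apply, smul_eq_mul,
    Finset.mul_sum, mul_assoc]
  rw [Finset.sum_comm]
  simp only [mul_left_comm]

theorem bilin_apply_eq_sum {A : Type*} [CommRing A] (T : Cov A (Cov A A)) (X Y : Vec A) :
    T X Y = ∑ a, ∑ b, X a * Y b * T (coordVec a) (coordVec b) :=
  bilin_eq_sum (F := fun X Y => T X Y) (by simp) (by simp) (by simp) (by simp) X Y

theorem quadrilin_apply_eq_sum {A : Type*} [CommRing A]
    (T : Cov A (Cov A (Cov A (Cov A A)))) (X Y Z U : Vec A) :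
    T X Y Z U = ∑ a, ∑ b, ∑ c, ∑ d,
      T (coordVec a) (coordVec b) (coordVec c) (coordVec d) * X a * Y b * Z c * U d := by
  rw [bilin_eq_sum (F := fun X Y => T X Y Z U) (by simp) (by simp) (by simp) (by simp) X Y]
  refine Finset.sum_congr rfl fun a _ => Finset.sum_congr rfl fun b _ => ?_
  rw [bilin_apply_eq_sum (T (coordVec a) (coordVec b)) Z U, Finset.mul_sum]
  refine Finset.sum_congr rfl fun c _ => ?_
  rw [Finset.mul_sum]
  exact Finset.sum_congr rfl fun d _ => by ring

namespace FrameMetric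

variable {A : Type*} [CommRing A] [Algebra ℝ A] (S : FrameMetric A)

/-- The covariant derivative of a family of components; the index of differentiation comes
first. -/
def cov {k : ℕ} (t : (Fin k → Fin 4) → A) (i : Fin (k + 1) → Fin 4) : A :=
  S.pd (i 0) (t (Fin.tail i))
    - ∑ s : Fin k, ∑ d : Fin 4, S.Γ d (i 0) (Fin.tail i s) * t (Function.update (Fin.tail i) s d)

theorem cov_one (L : Cov A A) (i : Fin 2 → Fin 4) :
    S.cov (fun j => L (coordVec (j 0))) i = S.D1 (i 0) L (coordVec (i 1)) := by
  simp [cov, FrameMetric.DX_coordVec, Fin.tail]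

theorem cov_four (L : Cov A (Cov A (Cov A
    (Cov A A)))) (i : Fin 5 → Fin 4) :
    S.cov (fun j => L (coordVec (j 0)) (coordVec (j 1)) (coordVec (j 2)) (coordVec (j 3))) i =
      S.D4 (i 0) L (coordVec (i 1)) (coordVec (i 2)) (coordVec (i 3))
        (coordVec (i 4)) := by
  have e0 : ∀ (x : Fin 4 → Fin 4) d, Function.update x 0 d = ![d, x 1, x 2, x 3] := fun x d => by
    ext j; fin_cases j <;> rfl
  have e1 : ∀ (x : Fin 4 → Fin 4) d, Function.update x 1 d = ![x 0, d, x 2, x 3] := fun x d => by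
    ext j; fin_cases j <;> rfl
  have e2 : ∀ (x : Fin 4 → Fin 4) d, Function.update x 2 d = ![x 0, x 1, d, x 3] := fun x d => by
    ext j; fin_cases j <;> rfl
  have e3 : ∀ (x : Fin 4 → Fin 4) d, Function.update x 3 d = ![x 0, x 1, x 2, d] := fun x d => by
    ext j; fin_cases j <;> rfl
  have hs : ∀ f : Fin 4 → A, ∑ s, f s = f 0 + f 1 + f 2 + f 3 := Fin.sum_univ_four
  rw [cov, hs]
  simp only [e0, e1, e2, e3]
  simp only [CovDer.hom_apply, LinearMap.sub_apply, CovDer.ofDerivation_apply,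
    FrameMetric.DX_coordVec, map_sum, map_smul, LinearMap.sum_apply, LinearMap.smul_apply,
    smul_eq_mul]
  simp only [Fin.tail, Matrix.cons_val, Fin.succ_zero_eq_one, Fin.succ_one_eq_two, Fin.reduceSucc]
  ring

theorem cov_five (L : Cov A (Cov A (Cov A
    (Cov A (Cov A A))))) (i : Fin 6 → Fin 4) :
    S.cov (fun j => L (coordVec (j 0)) (coordVec (j 1)) (coordVec (j 2)) (coordVec (j 3))
      (coordVec (j 4))) i =
      S.D5 (i 0) L (coordVec (i 1)) (coordVec (i 2)) (coordVec (i 3))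
        (coordVec (i 4)) (coordVec (i 5)) := by
  have e0 : ∀ (x : Fin 5 → Fin 4) d, Function.update x 0 d = ![d, x 1, x 2, x 3, x 4] :=
    fun x d => by ext j; fin_cases j <;> rfl
  have e1 : ∀ (x : Fin 5 → Fin 4) d, Function.update x 1 d = ![x 0, d, x 2, x 3, x 4] :=
    fun x d => by ext j; fin_cases j <;> rfl
  have e2 : ∀ (x : Fin 5 → Fin 4) d, Function.update x 2 d = ![x 0, x 1, d, x 3, x 4] :=
    fun x d => by ext j; fin_cases j <;> rfl
  have e3 : ∀ (x : Fin 5 → Fin 4) d, Function.update x 3 d = ![x 0, x 1, x 2, d, x 4] :=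
    fun x d => by ext j; fin_cases j <;> rfl
  have e4 : ∀ (x : Fin 5 → Fin 4) d, Function.update x 4 d = ![x 0, x 1, x 2, x 3, d] :=
    fun x d => by ext j; fin_cases j <;> rfl
  have hs : ∀ f : Fin 5 → A, ∑ s, f s = f 0 + f 1 + f 2 + f 3 + f 4 :=
    Fin.sum_univ_five
  rw [cov, hs]
  simp only [e0, e1, e2, e3, e4]
  simp only [CovDer.hom_apply, LinearMap.sub_apply, CovDer.ofDerivation_apply,
    FrameMetric.DX_coordVec, map_sum, map_smul, LinearMap.sum_apply, LinearMap.smul_apply,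
    smul_eq_mul]
  simp only [Fin.tail, Matrix.cons_val, Fin.succ_zero_eq_one, Fin.succ_one_eq_two, Fin.reduceSucc]
  ring

/-- The components of the Weyl tensor. -/
def WComp (i : Fin 4 → Fin 4) : A :=
  S.W (coordVec (i 0)) (coordVec (i 1)) (coordVec (i 2)) (coordVec (i 3))

theorem cov_cov_WComp (i : Fin 6 → Fin 4) : S.cov (S.cov S.WComp) i =
    S.nabla S.D5 (S.nabla S.D4 S.W) (coordVec (i 0)) (coordVec (i 1)) (coordVec (i 2))
      (coordVec (i 3)) (coordVec (i 4)) (coordVec (i 5)) := by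
  have h : S.cov S.WComp = fun j => S.nabla S.D4 S.W (coordVec (j 0)) (coordVec (j 1))
      (coordVec (j 2)) (coordVec (j 3)) (coordVec (j 4)) := funext fun j => by
    rw [nabla_coordVec]
    exact S.cov_four S.W j
  rw [h, cov_five, nabla_coordVec]

theorem bach_coordVec (a b : Fin 4) : S.bach (coordVec a) (coordVec b) =
    (∑ c, ∑ d, ∑ e, ∑ f, S.H c e * S.H d f * S.cov (S.cov S.WComp) ![e, f, a, c, b, d])
    + algebraMap ℝ A (1 / 2) * ∑ c, ∑ d, (∑ e, ∑ f, S.H c e * S.H d f *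
      S.Ric (coordVec e) (coordVec f)) * S.WComp ![a, c, b, d] := by
  simp only [cov_cov_WComp, WComp, Matrix.cons_val, bach]

theorem bach_eq_sum (X Y : Vec A) :
    S.bach X Y = ∑ a, ∑ b, X a * Y b * S.bach (coordVec a) (coordVec b) := by
  refine bilin_eq_sum (fun X X' Y => ?_) (fun f X Y => ?_) (fun X Y Y' => ?_) (fun f X Y => ?_) X Y
  · simp only [bach, map_add, LinearMap.add_apply, mul_add, Finset.sum_add_distrib]
    ring
  · simp only [bach, map_smul, LinearMap.smul_apply, smul_eq_mul, mul_left_comm _ f,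
      ← Finset.mul_sum, ← mul_add]
  · simp only [bach, map_add, LinearMap.add_apply, mul_add, Finset.sum_add_distrib]
    ring
  · simp only [bach, map_smul, LinearMap.smul_apply, smul_eq_mul, mul_left_comm _ f,
      ← Finset.mul_sum, ← mul_add]

end FrameMetric

/-! ### The algebra of smooth functions on an open set of coordinates -/

/-- Extension by zero of a function on an open subset of the coordinate space. -/
def extZero {V : TopologicalSpace.Opens E4} (f : V → ℝ) : E4 → ℝ :=
  open Classical in fun y => if h : y ∈ V then f ⟨y, h⟩ else 0

theorem extZero_coe {V : TopologicalSpace.Opens E4} (f : V → ℝ) (y : V) : extZero f y = f y := by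
  simp [extZero]

theorem extZero_of_mem {V : TopologicalSpace.Opens E4} (f : V → ℝ) {y : E4} (h : y ∈ V) :
    extZero f y = f ⟨y, h⟩ := by
  simp [extZero, h]

/-- The algebra of smooth real functions on an open subset of the coordinate space. -/
def smoothFun (V : TopologicalSpace.Opens E4) : Subalgebra ℝ (V → ℝ) where
  carrier := {f | ContDiffOn ℝ ∞ (extZero f) V}
  mul_mem' {f g} hf hg := (ContDiffOn.mul hf hg).congr fun y hy => by
    simp only [extZero_of_mem _ hy, Pi.mul_apply]
  add_mem' {f g} hf hg := (ContDiffOn.add hf hg).congr fun y hy => by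
    simp only [extZero_of_mem _ hy, Pi.add_apply]
  algebraMap_mem' r := (contDiffOn_const (c := r)).congr fun y hy => by
    simp only [extZero_of_mem _ hy, Pi.algebraMap_apply, Algebra.algebraMap_self, RingHom.id_apply]

namespace smoothFun

variable {V : TopologicalSpace.Opens E4}

/-- Evaluation at a point. -/
def ev (y : V) : smoothFun V →ₐ[ℝ] ℝ := (Pi.evalAlgHom ℝ (fun _ : V => ℝ) y).comp (smoothFun V).val

theorem ev_apply (y : V) (f : smoothFun V) : ev y f = (f : V → ℝ) y := rfl

theorem ext_ev {f g : smoothFun V} (h : ∀ y, ev y f = ev y g) : f = g :=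
  Subtype.ext (funext h)

theorem contDiffOn_extZero (f : smoothFun V) : ContDiffOn ℝ ∞ (extZero (f : V → ℝ)) V := f.2

/-- The restriction of a smooth function. -/
def restrict (F : E4 → ℝ) (hF : ContDiffOn ℝ ∞ F V) : smoothFun V :=
  ⟨fun y => F y, hF.congr fun y hy => by rw [extZero_of_mem _ hy]⟩

@[simp] theorem ev_restrict (F : E4 → ℝ) (hF : ContDiffOn ℝ ∞ F V) (y : V) :
    ev y (restrict F hF) = F y := rfl

theorem pderiv_congr {F F' : E4 → ℝ} (h : ∀ y ∈ V, F y = F' y) (i : Fin 4) {y : E4} (hy : y ∈ V) :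
    pderiv i F y = pderiv i F' y := by
  have e : F =ᶠ[nhds y] F' := Filter.eventually_of_mem (V.isOpen.mem_nhds hy) h
  rw [pderiv, pderiv, e.fderiv_eq]

theorem contDiffOn_pderiv {F : E4 → ℝ} (hF : ContDiffOn ℝ ∞ F V) (i : Fin 4) :
    ContDiffOn ℝ ∞ (pderiv i F) V :=
  (hF.fderiv_of_isOpen V.isOpen (m := ∞) (by simp)).clm_apply contDiffOn_const

theorem differentiableAt {F : E4 → ℝ} (hF : ContDiffOn ℝ ∞ F V) {y : E4} (hy : y ∈ V) :
    DifferentiableAt ℝ F y :=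
  (hF.contDiffAt (V.isOpen.mem_nhds hy)).differentiableAt (by simp)

theorem pderiv_add {F F' : E4 → ℝ} (hF : ContDiffOn ℝ ∞ F V) (hF' : ContDiffOn ℝ ∞ F' V)
    (i : Fin 4) {y : E4} (hy : y ∈ V) :
    pderiv i (fun z => F z + F' z) y = pderiv i F y + pderiv i F' y := by
  rw [pderiv, fderiv_fun_add (differentiableAt hF hy) (differentiableAt hF' hy)]
  rfl

theorem pderiv_mul {F F' : E4 → ℝ} (hF : ContDiffOn ℝ ∞ F V) (hF' : ContDiffOn ℝ ∞ F' V)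
    (i : Fin 4) {y : E4} (hy : y ∈ V) :
    pderiv i (fun z => F z * F' z) y = F y * pderiv i F' y + F' y * pderiv i F y := by
  rw [pderiv, fderiv_fun_mul (differentiableAt hF hy) (differentiableAt hF' hy)]
  rfl

/-- The partial derivative of a smooth function, as a smooth function. -/
def pdFun (i : Fin 4) (f : smoothFun V) : smoothFun V :=
  restrict (pderiv i (extZero (f : V → ℝ))) (contDiffOn_pderiv (contDiffOn_extZero f) i)

theorem pderiv_eq_ev_pdFun {F : E4 → ℝ} {f : smoothFun V} (h : ∀ y : V, F y = ev y f) (i : Fin 4)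
    (y : V) : pderiv i F y = ev y (pdFun i f) :=
  pderiv_congr (fun z hz => by rw [extZero_of_mem _ hz]; exact h ⟨z, hz⟩) i y.2

theorem pdFun_add (i : Fin 4) (f f' : smoothFun V) :
    pdFun i (f + f') = pdFun i f + pdFun i f' := by
  refine ext_ev fun y => ?_
  rw [map_add, ← pderiv_eq_ev_pdFun (F := fun z => extZero (f : V → ℝ) z + extZero (f' : V → ℝ) z)
    (fun z => by rw [extZero_coe, extZero_coe, map_add, ev_apply, ev_apply])]
  exact pderiv_add (contDiffOn_extZero f) (contDiffOn_extZero f') i y.2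

theorem pdFun_mul (i : Fin 4) (f f' : smoothFun V) :
    pdFun i (f * f') = f * pdFun i f' + f' * pdFun i f := by
  refine ext_ev fun y => ?_
  rw [map_add, map_mul, map_mul,
    ← pderiv_eq_ev_pdFun (F := fun z => extZero (f : V → ℝ) z * extZero (f' : V → ℝ) z)
    (fun z => by rw [extZero_coe, extZero_coe, map_mul, ev_apply, ev_apply]),
    pderiv_mul (contDiffOn_extZero f) (contDiffOn_extZero f') i y.2, extZero_coe, extZero_coe]
  rfl

theorem pdFun_algebraMap (i : Fin 4) (r : ℝ) : pdFun i (algebraMap ℝ (smoothFun V) r) = 0 := by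
  refine ext_ev fun y => ?_
  rw [map_zero, ← pderiv_eq_ev_pdFun (F := fun _ => r) (fun z => by rw [AlgHom.commutes]; rfl),
    pderiv, fderiv_fun_const]
  rfl

/-- Partial derivatives of smooth functions. -/
def pd (i : Fin 4) : Derivation ℝ (smoothFun V) (smoothFun V) :=
  Derivation.mk'
    { toFun := pdFun i
      map_add' := pdFun_add i
      map_smul' := fun r f => by
        rw [Algebra.smul_def, pdFun_mul, pdFun_algebraMap, mul_zero, add_zero, RingHom.id_apply,
          Algebra.smul_def] }
    (pdFun_mul i)

/-- Partial derivatives only depend on the values on `V`. -/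
theorem pderiv_eq_ev {F : E4 → ℝ} {f : smoothFun V} (h : ∀ y : V, F y = ev y f) (i : Fin 4)
    (y : V) : pderiv i F y = ev y (pd i f) :=
  pderiv_eq_ev_pdFun h i y

theorem pd_comm (i j : Fin 4) (f : smoothFun V) : pd i (pd j f) = pd j (pd i f) := by
  refine ext_ev fun y => ?_
  have h : ∀ i j, ev y (pd i (pd j f)) =
      fderiv ℝ (fderiv ℝ (extZero (f : V → ℝ))) y (EuclideanSpace.single i 1)
        (EuclideanSpace.single j 1) := fun i j => by
    have e := pderiv_eq_ev (F := pderiv j (extZero (f : V → ℝ))) (f := pd j f) (fun _ => rfl) i y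
    rw [← e]
    have hd : DifferentiableAt ℝ (fderiv ℝ (extZero (f : V → ℝ))) y :=
      (((contDiffOn_extZero f).fderiv_of_isOpen V.isOpen (m := ∞) (by simp)).contDiffAt
        (V.isOpen.mem_nhds y.2)).differentiableAt (by simp)
    change fderiv ℝ (fun z => fderiv ℝ (extZero (f : V → ℝ)) z (EuclideanSpace.single j 1)) y
      (EuclideanSpace.single i 1) = _
    rw [fderiv_clm_apply hd (differentiableAt_const _)]
    simp
  rw [h, h]
  exact ((contDiffOn_extZero f).contDiffAt (V.isOpen.mem_nhds y.2)).isSymmSndFDerivAt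
    (by simp; exact WithTop.coe_le_coe.2 le_top) _ _

end smoothFun

/-! ### Coordinate tensor calculus in terms of the algebra of smooth functions -/

/-- A smooth metric with a null frame in local coordinates. -/
structure IsFrameOn (V : TopologicalSpace.Opens E4) (G : E4 → Matrix (Fin 4) (Fin 4) ℝ)
    (l n p q : Fin 4 → E4 → ℝ) : Prop where
  smooth_G : ∀ a b, ContDiffOn ℝ ∞ (fun y => G y a b) V
  smooth_l : ∀ a, ContDiffOn ℝ ∞ (l a) V
  smooth_n : ∀ a, ContDiffOn ℝ ∞ (n a) V
  smooth_p : ∀ a, ContDiffOn ℝ ∞ (p a) V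
  smooth_q : ∀ a, ContDiffOn ℝ ∞ (q a) V
  G_symm : ∀ y ∈ V, ∀ a b, G y a b = G y b a
  ll : ∀ y ∈ V, (fun a => l a y) ⬝ᵥ (G y).mulVec (fun a => l a y) = 0
  nn : ∀ y ∈ V, (fun a => n a y) ⬝ᵥ (G y).mulVec (fun a => n a y) = 0
  ln : ∀ y ∈ V, (fun a => l a y) ⬝ᵥ (G y).mulVec (fun a => n a y) = 1
  lp : ∀ y ∈ V, (fun a => l a y) ⬝ᵥ (G y).mulVec (fun a => p a y) = 0
  lq : ∀ y ∈ V, (fun a => l a y) ⬝ᵥ (G y).mulVec (fun a => q a y) = 0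
  np : ∀ y ∈ V, (fun a => n a y) ⬝ᵥ (G y).mulVec (fun a => p a y) = 0
  nq : ∀ y ∈ V, (fun a => n a y) ⬝ᵥ (G y).mulVec (fun a => q a y) = 0
  pp : ∀ y ∈ V, (fun a => p a y) ⬝ᵥ (G y).mulVec (fun a => p a y) = 1
  pq : ∀ y ∈ V, (fun a => p a y) ⬝ᵥ (G y).mulVec (fun a => q a y) = 0
  qq : ∀ y ∈ V, (fun a => q a y) ⬝ᵥ (G y).mulVec (fun a => q a y) = 1

namespace IsFrameOn

open smoothFun

variable {V : TopologicalSpace.Opens E4} {G : E4 → Matrix (Fin 4) (Fin 4) ℝ}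
  {l n p q : Fin 4 → E4 → ℝ} (h : IsFrameOn V G l n p q)

/-- The Gram relations, as identities between smooth functions. -/
theorem gram_eq (h : IsFrameOn V G l n p q) {X Y : Fin 4 → E4 → ℝ}
    (hX : ∀ a, ContDiffOn ℝ ∞ (X a) V)
    (hY : ∀ a, ContDiffOn ℝ ∞ (Y a) V) {r : ℝ}
    (e : ∀ y ∈ V, (fun a => X a y) ⬝ᵥ (G y).mulVec (fun a => Y a y) = r) :
    (fun a => restrict (X a) (hX a)) ⬝ᵥ Matrix.mulVec
      (Matrix.of fun a b => restrict (fun y => G y a b) (h.smooth_G a b))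
      (fun a => restrict (Y a) (hY a))
      = algebraMap ℝ (smoothFun V) r := by
  refine ext_ev fun y => ?_
  rw [AlgHom.commutes, Algebra.algebraMap_self, RingHom.id_apply, ← e y y.2]
  simp only [dotProduct, Matrix.mulVec, map_sum, map_mul, ev_restrict, Matrix.of_apply]

/-- The metric and the frame over the algebra of smooth functions. -/
def toFrameMetric : FrameMetric (smoothFun V) where
  pd := pd
  pd_comm := pd_comm
  G := Matrix.of fun a b => restrict (fun y => G y a b) (h.smooth_G a b)
  G_symm a b := ext_ev fun y => h.G_symm y y.2 a b
  l a := restrict (l a) (h.smooth_l a)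
  n a := restrict (n a) (h.smooth_n a)
  p a := restrict (p a) (h.smooth_p a)
  q a := restrict (q a) (h.smooth_q a)
  ll := (h.gram_eq h.smooth_l h.smooth_l h.ll).trans (map_zero _)
  nn := (h.gram_eq h.smooth_n h.smooth_n h.nn).trans (map_zero _)
  ln := (h.gram_eq h.smooth_l h.smooth_n h.ln).trans (map_one _)
  lp := (h.gram_eq h.smooth_l h.smooth_p h.lp).trans (map_zero _)
  lq := (h.gram_eq h.smooth_l h.smooth_q h.lq).trans (map_zero _)
  np := (h.gram_eq h.smooth_n h.smooth_p h.np).trans (map_zero _)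
  nq := (h.gram_eq h.smooth_n h.smooth_q h.nq).trans (map_zero _)
  pp := (h.gram_eq h.smooth_p h.smooth_p h.pp).trans (map_one _)
  pq := (h.gram_eq h.smooth_p h.smooth_q h.pq).trans (map_zero _)
  qq := (h.gram_eq h.smooth_q h.smooth_q h.qq).trans (map_one _)

theorem ev_G (a b : Fin 4) (y : V) : ev y (h.toFrameMetric.G a b) = G y a b := rfl

theorem ev_H (a b : Fin 4) (y : V) : ev y (h.toFrameMetric.H a b) = (G y)⁻¹ a b := by
  have e := mul_completeness_eq_one (G y) (h.G_symm y y.2) _ _ _ _ (h.ll y y.2) (h.nn y y.2)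
    (h.ln y y.2) (h.lp y y.2) (h.lq y y.2) (h.np y y.2) (h.nq y y.2) (h.pp y y.2) (h.pq y y.2)
    (h.qq y y.2)
  rw [Matrix.inv_eq_right_inv e]
  simp only [FrameMetric.H, map_add, map_mul]
  rfl

theorem ev_Γ (a b c : Fin 4) (y : V) :
    christoffel G a b c y = ev y (h.toFrameMetric.Γ a b c) := by
  have e : ∀ i a b, pderiv i (fun z => G z a b) y =
      ev y (h.toFrameMetric.pd i (h.toFrameMetric.G a b)) := fun i a b =>
    pderiv_eq_ev (f := h.toFrameMetric.G a b) (fun y => (h.ev_G a b y).symm) i y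
  simp only [christoffel, FrameMetric.Γ, map_mul, map_sum, map_add, map_sub, AlgHom.commutes,
    Algebra.algebraMap_self, RingHom.id_apply, e, ev_H]

theorem ev_Rup (a b c d : Fin 4) (y : V) :
    riemannUp G a b c d y = ev y (h.toFrameMetric.Rup a b c d) := by
  have e : ∀ i a b c, pderiv i (christoffel G a b c) y =
      ev y (h.toFrameMetric.pd i (h.toFrameMetric.Γ a b c)) := fun i a b c =>
    pderiv_eq_ev (f := h.toFrameMetric.Γ a b c) (h.ev_Γ a b c) i y
  simp only [riemannUp, FrameMetric.Rup, map_mul, map_sum, map_add, map_sub, e, ev_Γ h]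

theorem ev_Ric (a b : Fin 4) (y : V) :
    ricci G a b y = ev y (h.toFrameMetric.Ric (coordVec a) (coordVec b)) := by
  simp only [ricci, FrameMetric.Ric, ext1_coordVec, map_sum, ev_Rup h]

theorem ev_scal (y : V) : scalarCurv G y = ev y h.toFrameMetric.scal := by
  simp only [scalarCurv, FrameMetric.scal, FrameMetric.tr, smul_eq_mul, map_sum, map_mul, ev_Ric h,
    ev_H]

theorem ev_W (a b c d : Fin 4) (y : V) : weyl G a b c d y =
    ev y (h.toFrameMetric.W (coordVec a) (coordVec b) (coordVec c) (coordVec d)) := by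
  simp only [weyl, riemann, ricci, FrameMetric.W, ext1_coordVec, map_sum, map_mul, map_add,
    map_sub, ev_Rup h, ev_scal h, ev_G, AlgHom.commutes, Algebra.algebraMap_self,
    RingHom.id_apply]
  ring

theorem ev_cov {k : ℕ} {T : CoordTensor k} {t : (Fin k → Fin 4) → smoothFun V}
    (hT : ∀ i (y : V), T i y = ev y (t i)) (i : Fin (k + 1) → Fin 4) (y : V) :
    covDeriv G T i y = ev y (h.toFrameMetric.cov t i) := by
  simp only [covDeriv, FrameMetric.cov, map_sub, map_sum, map_mul, ev_Γ h, hT]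
  rw [pderiv_eq_ev (f := t (Fin.tail i)) (hT _)]
  rfl

theorem ev_WComp (i : Fin 4 → Fin 4) (y : V) :
    weylTensor G i y = ev y (h.toFrameMetric.WComp i) :=
  h.ev_W (i 0) (i 1) (i 2) (i 3) y

theorem ev_bach (a b : Fin 4) (y : V) : QuadraticGravity.bach G a b y =
    ev y (h.toFrameMetric.bach (coordVec a) (coordVec b)) := by
  have hW : ∀ a b c d, weyl G a b c d y = ev y (h.toFrameMetric.WComp ![a, b, c, d]) :=
    fun a b c d => h.ev_WComp ![a, b, c, d] y
  rw [FrameMetric.bach_coordVec]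
  simp only [QuadraticGravity.bach, ricciUp, h.ev_cov (h.ev_cov h.ev_WComp), hW, ev_Ric h,
    map_add, map_mul, map_sum, AlgHom.commutes, Algebra.algebraMap_self, RingHom.id_apply, ev_H]

end IsFrameOn

namespace FrameMetric

variable {A : Type*} [CommRing A] [Algebra ℝ A] (S : FrameMetric A)

theorem g_coordVec_left (a : Fin 4) (X : Vec A) :
    S.g (coordVec a) X = ∑ b, S.G a b * X b := by
  conv_lhs => rw [eq_sum_coordVec X]
  simp only [map_sum, map_smul, g_coordVec, smul_eq_mul, mul_comm]

theorem cov_lower (X : Vec A) (i : Fin 2 → Fin 4) :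
    S.cov (fun j : Fin 1 → Fin 4 => S.g X (coordVec (j 0))) i =
      S.g (S.DX (i 0) X) (coordVec (i 1)) := by
  rw [cov_one, CovDer.hom_apply, CovDer.ofDerivation_apply, pd_g, add_sub_cancel_right]

theorem sum_mul_g_DX (X Y Z : Vec A) : ∑ a, ∑ b, S.g (S.DX b Z) (coordVec a) * X a * Y b =
    S.g X (S.DV Y Z) := by
  rw [Finset.sum_comm, DV, nabla_apply, map_sum]
  refine Finset.sum_congr rfl fun b _ => ?_
  conv_rhs => rw [eq_sum_coordVec X]
  simp only [map_sum, map_smul, LinearMap.sum_apply, LinearMap.smul_apply, smul_eq_mul,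
    Finset.mul_sum]
  exact Finset.sum_congr rfl fun a _ => by rw [S.g_symm]; ring

/-- Second covariant derivatives of constants vanish. -/
theorem cov_cov_algebraMap (r : ℝ) (i : Fin 2 → Fin 4) :
    S.cov (S.cov fun _ : Fin 0 → Fin 4 => algebraMap ℝ A r) i = 0 := by
  have h : (S.cov fun _ : Fin 0 → Fin 4 => algebraMap ℝ A r) = fun _ => 0 :=
    funext fun j => by simp [cov]
  rw [h]
  simp [cov]

/-- The traceless type III form of the Ricci tensor at a point, from components. -/
theorem ric_eq_of_coordVec (φ : A →ₐ[ℝ] ℝ) {Λ ψ χ w : ℝ}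
    (hRic : ∀ a b, φ (S.Ric (coordVec a) (coordVec b)) =
      Λ * φ (S.g (coordVec a) (coordVec b))
      + (ψ * (φ (S.g S.l (coordVec a)) * φ (S.g S.p (coordVec b))
          + φ (S.g S.p (coordVec a)) * φ (S.g S.l (coordVec b)))
        + χ * (φ (S.g S.l (coordVec a)) * φ (S.g S.q (coordVec b))
          + φ (S.g S.q (coordVec a)) * φ (S.g S.l (coordVec b))))
      + w * φ (S.g S.l (coordVec a)) * φ (S.g S.l (coordVec b))) (X Y : Vec A) :
    φ (S.Ric X Y) = Λ * φ (S.g X Y)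
      + (ψ * (φ (S.g S.l X) * φ (S.g S.p Y) + φ (S.g S.p X) * φ (S.g S.l Y))
        + χ * (φ (S.g S.l X) * φ (S.g S.q Y) + φ (S.g S.q X) * φ (S.g S.l Y)))
      + w * φ (S.g S.l X) * φ (S.g S.l Y) := by
  refine vec_induction (P := fun X => φ (S.Ric X Y) = Λ * φ (S.g X Y)
    + (ψ * (φ (S.g S.l X) * φ (S.g S.p Y) + φ (S.g S.p X) * φ (S.g S.l Y))
      + χ * (φ (S.g S.l X) * φ (S.g S.q Y) + φ (S.g S.q X) * φ (S.g S.l Y)))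
    + w * φ (S.g S.l X) * φ (S.g S.l Y)) (fun a => ?_) (fun X X' e e' => ?_)
    (fun f X e => ?_) X
  · refine vec_induction (P := fun Y => φ (S.Ric (coordVec a) Y) =
      Λ * φ (S.g (coordVec a) Y)
      + (ψ * (φ (S.g S.l (coordVec a)) * φ (S.g S.p Y)
          + φ (S.g S.p (coordVec a)) * φ (S.g S.l Y))
        + χ * (φ (S.g S.l (coordVec a)) * φ (S.g S.q Y)
          + φ (S.g S.q (coordVec a)) * φ (S.g S.l Y)))
      + w * φ (S.g S.l (coordVec a)) * φ (S.g S.l Y)) (fun b => hRic a b)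
      (fun X X' e e' => ?_) (fun f X e => ?_) Y
    · simp only [map_add]
      linear_combination e + e'
    · simp only [map_smul, smul_eq_mul, map_mul]
      linear_combination φ f * e
  · simp only [map_add, LinearMap.add_apply]
    linear_combination e + e'
  · simp only [map_smul, LinearMap.smul_apply, smul_eq_mul, map_mul]
    linear_combination φ f * e

end FrameMetric

/-! ### The theorem in a coordinate domain -/

namespace IsFrameOn

open smoothFun

variable {V : TopologicalSpace.Opens E4} {G : E4 → Matrix (Fin 4) (Fin 4) ℝ}
  {l n p q : Fin 4 → E4 → ℝ} (h : IsFrameOn V G l n p q)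

/-- Lowering of an index. -/
def lower (G : E4 → Matrix (Fin 4) (Fin 4) ℝ) (X : Fin 4 → E4 → ℝ) (a : Fin 4) (y : E4) : ℝ :=
  ∑ b, G y a b * X b y

theorem ev_lower {X : Fin 4 → E4 → ℝ} {x : Vec (smoothFun V)} (hX : ∀ a (y : V), X a y = ev y (x a))
    (a : Fin 4) (y : V) : lower G X a y = ev y (h.toFrameMetric.g x (coordVec a)) := by
  rw [FrameMetric.g_symm, FrameMetric.g_coordVec_left]
  simp only [lower, map_sum, map_mul, ev_G, hX]

theorem ev_cov_lower {X : Fin 4 → E4 → ℝ} {x : Vec (smoothFun V)}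
    (hX : ∀ a (y : V), X a y = ev y (x a)) (b a : Fin 4) (y : V) :
    covDeriv G (k := 1) (fun i => lower G X (i 0)) ![b, a] y =
      ev y (h.toFrameMetric.g (h.toFrameMetric.DX b x) (coordVec a)) := by
  rw [h.ev_cov (T := fun i => lower G X (i 0)) (t := fun j => h.toFrameMetric.g x (coordVec (j 0)))
    (fun i y => h.ev_lower hX (i 0) y), FrameMetric.cov_lower]
  rfl

/-- The contracted Ricci tensor, if the Ricci tensor is that of the theorem at a point. -/
theorem ev_Ric_eq {Λ ψ χ w : ℝ} {y : V} (hRic : ∀ a b, ricci G a b y = Λ * G y a b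
      + (ψ * (lower G l a y * lower G p b y + lower G p a y * lower G l b y)
        + χ * (lower G l a y * lower G q b y + lower G q a y * lower G l b y))
      + w * lower G l a y * lower G l b y) {S : FrameMetric (smoothFun V)}
    (hS : h.toFrameMetric = S) (X Y : Vec (smoothFun V)) :
    ev y (S.Ric X Y) = Λ * ev y (S.g X Y)
      + (ψ * (ev y (S.g S.l X) * ev y (S.g S.p Y) + ev y (S.g S.p X) * ev y (S.g S.l Y))
        + χ * (ev y (S.g S.l X) * ev y (S.g S.q Y) + ev y (S.g S.q X) * ev y (S.g S.l Y)))
      + w * ev y (S.g S.l X) * ev y (S.g S.l Y) := by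
  have hl : ∀ a (y : V), l a y = ev y (S.l a) := fun _ _ => hS ▸ rfl
  have hp : ∀ a (y : V), p a y = ev y (S.p a) := fun _ _ => hS ▸ rfl
  have hq : ∀ a (y : V), q a y = ev y (S.q a) := fun _ _ => hS ▸ rfl
  have eG : ∀ a b, G y a b = ev y (S.g (coordVec a) (coordVec b)) := fun a b => by
    rw [FrameMetric.g_coordVec, ← hS, h.ev_G]
  refine S.ric_eq_of_coordVec (ev y) (fun a b => ?_) X Y
  have hab := hRic a b
  rwa [h.ev_Ric, eG, h.ev_lower hl, h.ev_lower hl, h.ev_lower hp, h.ev_lower hp, h.ev_lower hq,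
    h.ev_lower hq, hS] at hab

/-- The hypotheses of the theorem in a coordinate domain. -/
structure IsSolution (V : TopologicalSpace.Opens E4) (G : E4 → Matrix (Fin 4) (Fin 4) ℝ)
    (l n p q : Fin 4 → E4 → ℝ) (γ' α' β' Λ : ℝ) (ψ χ w : E4 → ℝ) : Prop where
  field : ∀ y ∈ V, ∀ a b, fieldTensor γ' α' β' Λ G a b y = 0
  ricci : ∀ y ∈ V, ∀ a b, ricci G a b y = Λ * G y a b
      + (ψ y * (lower G l a y * lower G p b y + lower G p a y * lower G l b y)
        + χ y * (lower G l a y * lower G q b y + lower G q a y * lower G l b y))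
      + w y * lower G l a y * lower G l b y
  ne_zero : ∀ y ∈ V, ψ y * ψ y + χ y * χ y ≠ 0
  weyl : ∀ A B C D : Fin 4, 0 < boostWeight A + boostWeight B + boostWeight C + boostWeight D →
    ∀ y ∈ V, ∑ a, ∑ b, ∑ c, ∑ d, weyl G a b c d y * (![l, n, p, q] : Fin 4 → _) A a y *
      (![l, n, p, q] : Fin 4 → _) B b y * (![l, n, p, q] : Fin 4 → _) C c y *
      (![l, n, p, q] : Fin 4 → _) D d y = 0

section

variable {γ' α' β' Λ : ℝ} {ψ χ w : E4 → ℝ}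

theorem ev_Ric_np (hs : IsSolution V G l n p q γ' α' β' Λ ψ χ w)
    (y : V) : ev y (h.toFrameMetric.Ric h.toFrameMetric.n h.toFrameMetric.p) = ψ y := by
  rw [h.ev_Ric_eq (hs.ricci y y.2) rfl]
  simp [FrameMetric.g_ln, FrameMetric.g_np, FrameMetric.g_lp, FrameMetric.g_pp, FrameMetric.g_pn,
    FrameMetric.g_qn, FrameMetric.g_qp]

theorem ev_Ric_nq (hs : IsSolution V G l n p q γ' α' β' Λ ψ χ w)
    (y : V) : ev y (h.toFrameMetric.Ric h.toFrameMetric.n h.toFrameMetric.q) = χ y := by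
  rw [h.ev_Ric_eq (hs.ricci y y.2) rfl]
  simp [FrameMetric.g_ln, FrameMetric.g_nq, FrameMetric.g_lq, FrameMetric.g_qq, FrameMetric.g_qn,
    FrameMetric.g_pn, FrameMetric.g_pq]

theorem ev_Ric_nn (hs : IsSolution V G l n p q γ' α' β' Λ ψ χ w)
    (y : V) : ev y (h.toFrameMetric.Ric h.toFrameMetric.n h.toFrameMetric.n) = w y := by
  rw [h.ev_Ric_eq (hs.ricci y y.2) rfl]
  simp [FrameMetric.g_ln, FrameMetric.g_nn, FrameMetric.g_pn, FrameMetric.g_qn]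

theorem ricTypeIII (hs : IsSolution V G l n p q γ' α' β' Λ ψ χ w)
    : h.toFrameMetric.RicTypeIII Λ
    (h.toFrameMetric.Ric h.toFrameMetric.n h.toFrameMetric.p)
    (h.toFrameMetric.Ric h.toFrameMetric.n h.toFrameMetric.q)
    (h.toFrameMetric.Ric h.toFrameMetric.n h.toFrameMetric.n) := fun X Y => ext_ev fun y => by
  rw [h.ev_Ric_eq (hs.ricci y y.2) rfl]
  simp only [map_add, map_mul, h.ev_Ric_np hs, h.ev_Ric_nq hs, h.ev_Ric_nn hs, AlgHom.commutes,
    Algebra.algebraMap_self, RingHom.id_apply]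
  ring

theorem wAligned (hs : IsSolution V G l n p q γ' α' β' Λ ψ χ w)
    : h.toFrameMetric.WAligned := fun a b c d habcd => ext_ev fun y => by
  have e : ∀ A i, (![l, n, p, q] : Fin 4 → _) A i y = ev y (h.toFrameMetric.frame A i) :=
    fun A i => by fin_cases A <;> rfl
  have hw := hs.weyl a b c d habcd y y.2
  simp only [e, h.ev_W] at hw
  rw [quadrilin_apply_eq_sum]
  simpa only [map_sum, map_mul, map_zero] using hw

/-- The field equations, contracted with two vector fields. Since `R = 4Λ` is constant, all
derivatives of `R` drop out and the remaining terms are multiples of `R_{ab} - Λ g_{ab}` and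
`B_{ab}`. -/
theorem field_eq (hs : IsSolution V G l n p q γ' α' β' Λ ψ χ w)
    (X Y : Vec (smoothFun V)) (y : V) : 4 * α' * ev y (h.toFrameMetric.bach X Y) =
    (γ' + 8 * β' * Λ) * (ev y (h.toFrameMetric.Ric X Y) - Λ * ev y (h.toFrameMetric.g X Y)) := by
  have hscal := (h.ricTypeIII hs).scal_eq
  have hsc : scalarCurv G y = 4 * Λ := by
    rw [h.ev_scal, hscal, AlgHom.commutes, Algebra.algebraMap_self, RingHom.id_apply]
  have hess : ∀ a b, hessScalar G a b y = 0 := fun a b => by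
    rw [hessScalar, h.ev_cov (h.ev_cov (T := fun _ : Fin 0 → Fin 4 => scalarCurv G)
      (t := fun _ => h.toFrameMetric.scal) (fun _ y => h.ev_scal y)), hscal,
      FrameMetric.cov_cov_algebraMap, map_zero]
  have hbox : boxScalar G y = 0 := by simp [boxScalar, hess]
  have key : ∀ a b, 4 * α' * ev y (h.toFrameMetric.bach (coordVec a) (coordVec b)) =
      (γ' + 8 * β' * Λ) * (ev y (h.toFrameMetric.Ric (coordVec a) (coordVec b))
        - Λ * ev y (h.toFrameMetric.g (coordVec a) (coordVec b))) := fun a b => by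
    have hf := hs.field y y.2 a b
    rw [fieldTensor, hsc, hess, hbox, h.ev_bach, h.ev_Ric, ← h.ev_G,
      ← FrameMetric.g_coordVec] at hf
    linear_combination -hf
  rw [FrameMetric.bach_eq_sum, bilin_apply_eq_sum h.toFrameMetric.Ric,
    bilin_apply_eq_sum h.toFrameMetric.g]
  simp only [map_sum, map_mul, Finset.mul_sum, ← Finset.sum_sub_distrib]
  refine Finset.sum_congr rfl fun a _ => Finset.sum_congr rfl fun b _ => ?_
  linear_combination ev y (X a) * ev y (Y b) * key a b

/-- The Bach tensor vanishes on `ℓ, m⁽ⁱ⁾`: unless `α'` is zero this is a component of the field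
equations, and if `α'` is zero, then the Ricci tensor is pure trace. -/
theorem ev_bach_eq_zero (hs : IsSolution V G l n p q γ' α' β' Λ ψ χ w)
    (hparam : α' ≠ 0 ∨ γ' + 8 * β' * Λ ≠ 0) (y : V) :
    ev y (h.toFrameMetric.bach h.toFrameMetric.l h.toFrameMetric.p) = 0 ∧
      ev y (h.toFrameMetric.bach h.toFrameMetric.l h.toFrameMetric.q) = 0 := by
  have hα : α' ≠ 0 := fun h0 => by
    have hγ := hparam.resolve_left (not_not.2 h0)
    have e1 := h.field_eq hs h.toFrameMetric.n h.toFrameMetric.p y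
    have e2 := h.field_eq hs h.toFrameMetric.n h.toFrameMetric.q y
    rw [h.ev_Ric_np hs, FrameMetric.g_np, h0] at e1
    rw [h.ev_Ric_nq hs, FrameMetric.g_nq, h0] at e2
    have f1 : ψ y = 0 := by simpa [hγ] using e1
    have f2 : χ y = 0 := by simpa [hγ] using e2
    exact hs.ne_zero y y.2 (by simp [f1, f2])
  have e1 := h.field_eq hs h.toFrameMetric.l h.toFrameMetric.p y
  have e2 := h.field_eq hs h.toFrameMetric.l h.toFrameMetric.q y
  rw [h.ricTypeIII hs] at e1 e2
  simp only [FrameMetric.g_ll, FrameMetric.g_lp, FrameMetric.g_lq, FrameMetric.g_pl,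
    FrameMetric.g_ql] at e1 e2
  constructor
  · simpa [hα] using e1
  · simpa [hα] using e2

/-- The integral curves of `ℓ` are geodesics. -/
theorem geodetic (h : IsFrameOn V G l n p q)
    (hs : IsSolution V G l n p q γ' α' β' Λ ψ χ w)
    {y : E4} (hy : y ∈ V) : ∃ f : ℝ, ∀ a,
    ∑ b, l b y * covDeriv G (k := 1) (fun i => lower G l (i 0)) ![b, a] y = f * lower G l a y := by
  have hne : ev ⟨y, hy⟩ (h.toFrameMetric.Ric h.toFrameMetric.n h.toFrameMetric.p)
      * ev ⟨y, hy⟩ (h.toFrameMetric.Ric h.toFrameMetric.n h.toFrameMetric.p)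
      + ev ⟨y, hy⟩ (h.toFrameMetric.Ric h.toFrameMetric.n h.toFrameMetric.q)
      * ev ⟨y, hy⟩ (h.toFrameMetric.Ric h.toFrameMetric.n h.toFrameMetric.q) ≠ 0 := by
    rw [h.ev_Ric_np hs, h.ev_Ric_nq hs]
    exact hs.ne_zero y hy
  obtain ⟨hp, hq⟩ := (h.ricTypeIII hs).geodetic (h.wAligned hs) (ev ⟨y, hy⟩) hne
  set S := h.toFrameMetric with hS
  have hl : ∀ a (y : V), l a y = ev y (S.l a) := fun _ _ => rfl
  refine ⟨ev ⟨y, hy⟩ (S.g S.n (S.DV S.l S.l)), fun a => ?_⟩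
  have e : ∑ b, l b y * covDeriv G (k := 1) (fun i => lower G l (i 0)) ![b, a] y =
      ev ⟨y, hy⟩ (S.g (S.DV S.l S.l) (coordVec a)) := by
    rw [FrameMetric.DV, FrameMetric.nabla_apply, map_sum, LinearMap.sum_apply, map_sum]
    refine Finset.sum_congr rfl fun b _ => ?_
    rw [map_smul, LinearMap.smul_apply, smul_eq_mul, map_mul, ← h.ev_cov_lower hl b a ⟨y, hy⟩]
    rfl
  rw [e, h.ev_lower hl a ⟨y, hy⟩, ← hS]
  conv_lhs => rw [S.DV_l]
  simp only [map_add, map_smul, LinearMap.add_apply, LinearMap.smul_apply, smul_eq_mul, map_mul,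
    hp, hq]
  ring

/-- The optical matrix of `ℓ` vanishes. -/
theorem optical (h : IsFrameOn V G l n p q)
    (hs : IsSolution V G l n p q γ' α' β' Λ ψ χ w)
    (hparam : α' ≠ 0 ∨ γ' + 8 * β' * Λ ≠ 0) {y : E4} (hy : y ∈ V) (i j : Fin 2) :
    ∑ a, ∑ b, covDeriv G (k := 1) (fun i => lower G l (i 0)) ![b, a] y *
      (![p, q] : Fin 2 → _) i a y * (![p, q] : Fin 2 → _) j b y = 0 := by
  have hne : ev ⟨y, hy⟩ (h.toFrameMetric.Ric h.toFrameMetric.n h.toFrameMetric.p)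
      * ev ⟨y, hy⟩ (h.toFrameMetric.Ric h.toFrameMetric.n h.toFrameMetric.p)
      + ev ⟨y, hy⟩ (h.toFrameMetric.Ric h.toFrameMetric.n h.toFrameMetric.q)
      * ev ⟨y, hy⟩ (h.toFrameMetric.Ric h.toFrameMetric.n h.toFrameMetric.q) ≠ 0 := by
    rw [h.ev_Ric_np hs, h.ev_Ric_nq hs]
    exact hs.ne_zero y hy
  obtain ⟨bp, bq⟩ := h.ev_bach_eq_zero hs hparam ⟨y, hy⟩
  obtain ⟨hpp, hpq, hqp, hqq⟩ :=
    (h.ricTypeIII hs).optical (h.wAligned hs) (ev ⟨y, hy⟩) hne bp bq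
  set S := h.toFrameMetric with hS
  have hl : ∀ a (y : V), l a y = ev y (S.l a) := fun _ _ => rfl
  have hm : ∀ i a, (![p, q] : Fin 2 → _) i a y = ev ⟨y, hy⟩ ((![S.p, S.q] : Fin 2 → _) i a) :=
    fun i a => by fin_cases i <;> rfl
  have hD : ∀ b a, covDeriv G (k := 1) (fun i => lower G l (i 0)) ![b, a] y =
      ev ⟨y, hy⟩ (S.g (S.DX b S.l) (coordVec a)) := fun b a => h.ev_cov_lower hl b a ⟨y, hy⟩
  simp only [hm, hD, ← map_mul, ← map_sum]
  rw [FrameMetric.sum_mul_g_DX]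
  fin_cases i <;> fin_cases j
  exacts [hpp, hpq, hqp, hqq]

end

end IsFrameOn

/-! ### From the manifold to coordinate domains -/

variable {M : Type*} [TopologicalSpace M] [ChartedSpace E4 M] [IsManifold (𝓡 4) ∞ M]

theorem mdifferentiable_of_mem_atlas {e : OpenPartialHomeomorph M E4} (he : e ∈ atlas E4 M) :
    e.MDifferentiable (𝓡 4) 𝓘(ℝ, E4) := by
  have : IsManifold (𝓡 4) 1 M := IsManifold.of_le (n := ∞) (by simp)
  exact ⟨mdifferentiableOn_atlas he, mdifferentiableOn_atlas_symm he⟩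

theorem contMDiffOn_of_mem_atlas {e : OpenPartialHomeomorph M E4} (he : e ∈ atlas E4 M) :
    ContMDiffOn (𝓡 4) 𝓘(ℝ, E4) ∞ e e.source :=
  contMDiffOn_of_mem_maximalAtlas (IsManifold.subset_maximalAtlas he)

theorem contMDiffOn_symm_of_mem_atlas {e : OpenPartialHomeomorph M E4} (he : e ∈ atlas E4 M) :
    ContMDiffOn 𝓘(ℝ, E4) (𝓡 4) ∞ e.symm e.target :=
  contMDiffOn_symm_of_mem_maximalAtlas (IsManifold.subset_maximalAtlas he)

/-- The components of a smooth vector field in a chart are smooth. -/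
theorem contDiffOn_vecInChart {U : Set M} {X : ∀ x : M, Tan x}
    (hX : ContMDiffOn (𝓡 4) (𝓡 4).tangent ∞ (fun x => (⟨x, X x⟩ : TangentBundle (𝓡 4) M)) U)
    {e : OpenPartialHomeomorph M E4} (he : e ∈ atlas E4 M) (i : Fin 4) :
    ContDiffOn ℝ ∞ (vecInChart X e i) (e.target ∩ e.symm ⁻¹' U) := by
  have h1 : ContMDiffOn (𝓡 4).tangent 𝓘(ℝ, E4).tangent ∞
      (tangentMapWithin (𝓡 4) 𝓘(ℝ, E4) e e.source)
      (Bundle.TotalSpace.proj ⁻¹' e.source) :=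
    (contMDiffOn_of_mem_atlas he).contMDiffOn_tangentMapWithin (by simp)
      e.open_source.uniqueMDiffOn
  have h2 := h1.comp (hX.comp ((contMDiffOn_symm_of_mem_atlas he).mono
    (Set.inter_subset_left (t := e.symm ⁻¹' U))) (fun y hy => hy.2))
    (fun y hy => e.map_target hy.1)
  have h3 : ContDiffOn ℝ ∞ (fun y => (show E4 from
      mfderiv (𝓡 4) 𝓘(ℝ, E4) e (e.symm y) (X (e.symm y)))) (e.target ∩ e.symm ⁻¹' U) := by
    refine (contMDiffOn_vectorSpace_iff_contDiffOn (V := fun y => (show E4 from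
      mfderiv (𝓡 4) 𝓘(ℝ, E4) e (e.symm y) (X (e.symm y))))).1 (h2.congr fun y hy => ?_)
    have hy' := e.map_target hy.1
    simp only [Function.comp_apply, tangentMapWithin]
    rw [mfderivWithin_of_isOpen e.open_source hy']
    exact Bundle.TotalSpace.ext (e.right_inv hy.1).symm HEq.rfl
  exact (contDiff_piLp_apply (p := 2) (i := i)).comp_contDiffOn h3

/-- The components of the metric in a chart are smooth. -/
theorem LorentzMetric.contDiffOn_inChart (g : LorentzMetric M) {e : OpenPartialHomeomorph M E4}
    (he : e ∈ atlas E4 M) (a b : Fin 4) :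
    ContDiffOn ℝ ∞ (fun y => g.inChart e y a b) e.target := by
  have hv : ∀ a : Fin 4, ContMDiffOn 𝓘(ℝ, E4) (𝓡 4).tangent ∞
      (fun y => (⟨e.symm y, mfderiv 𝓘(ℝ, E4) (𝓡 4) e.symm y
        (EuclideanSpace.single a (1 : ℝ) : E4)⟩ : TangentBundle (𝓡 4) M)) e.target := fun a => by
    have h1 : ContMDiffOn 𝓘(ℝ, E4).tangent (𝓡 4).tangent ∞
        (tangentMapWithin 𝓘(ℝ, E4) (𝓡 4) e.symm e.target)
        (Bundle.TotalSpace.proj ⁻¹' e.target) :=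
      (contMDiffOn_symm_of_mem_atlas he).contMDiffOn_tangentMapWithin (by simp)
        e.open_target.uniqueMDiffOn
    have h2 : ContMDiffOn 𝓘(ℝ, E4) 𝓘(ℝ, E4).tangent ∞ (fun y : E4 =>
        (⟨y, (EuclideanSpace.single a (1 : ℝ) : E4)⟩ : TangentBundle 𝓘(ℝ, E4) E4)) e.target :=
      contMDiffOn_vectorSpace_iff_contDiffOn.2 contDiffOn_const
    refine (h1.comp h2 fun y hy => hy).congr fun y hy => ?_
    simp only [Function.comp_apply, tangentMapWithin]
    rw [mfderivWithin_of_isOpen e.open_target hy]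
  have h := ContMDiffOn.clm_bundle_apply₂ (F₁ := E4) (F₂ := E4) (F₃ := ℝ)
    (E₃ := Bundle.Trivial M ℝ)
    (g.contMDiff.comp_contMDiffOn (contMDiffOn_symm_of_mem_atlas he)) (hv a) (hv b)
  intro y hy
  have hy2 := h y hy
  simp only [Bundle.contMDiffWithinAt_totalSpace] at hy2
  exact hy2.2.contDiffWithinAt

/-- The inner product of two vector fields in components. -/
theorem LorentzMetric.inner_eq (g : LorentzMetric M) (X Y : ∀ x : M, Tan x)
    {e : OpenPartialHomeomorph M E4} (he : e ∈ atlas E4 M) {y : E4} (hy : y ∈ e.target) :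
    (fun a => vecInChart X e a y) ⬝ᵥ (g.inChart e y).mulVec (fun a => vecInChart Y e a y) =
      g.inner (e.symm y) (X (e.symm y)) (Y (e.symm y)) := by
  have hE : ∀ v : E4, v = ∑ a, v a • EuclideanSpace.single a (1 : ℝ) := fun v => by
    ext b
    simp [Finset.sum_apply, Pi.single_apply]
  have key : ∀ X : ∀ x : M, Tan x, X (e.symm y) = ∑ a, vecInChart X e a y •
      mfderiv 𝓘(ℝ, E4) (𝓡 4) e.symm y (EuclideanSpace.single a (1 : ℝ) : E4) := fun X => by
    have h := (mdifferentiable_of_mem_atlas he).symm_comp_deriv (e.map_target hy)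
    rw [e.right_inv hy] at h
    have h2 : X (e.symm y) = mfderiv 𝓘(ℝ, E4) (𝓡 4) e.symm y
        (show E4 from mfderiv (𝓡 4) 𝓘(ℝ, E4) e (e.symm y) (X (e.symm y))) :=
      (congrArg (fun T => T (X (e.symm y))) h).symm
    rw [hE (show E4 from mfderiv (𝓡 4) 𝓘(ℝ, E4) e (e.symm y) (X (e.symm y)))] at h2
    refine h2.trans ((map_sum _ _ _).trans (Finset.sum_congr rfl fun a _ => ?_))
    exact map_smul _ _ _
  rw [key X, key Y]
  simp only [map_sum, map_smul, FunLike.coe_sum, Finset.sum_apply, smul_apply,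
    smul_eq_mul, dotProduct, Matrix.mulVec, Finset.mul_sum, LorentzMetric.inChart, Matrix.of_apply]
  rw [Finset.sum_comm]
  refine Finset.sum_congr rfl fun a _ => Finset.sum_congr rfl fun b _ => ?_
  ring

/-- The part of the domain of the coordinates `e` that represents the open set `U`. -/
def coordDomain {U : Set M} (hU : IsOpen U) (e : OpenPartialHomeomorph M E4) :
    TopologicalSpace.Opens E4 :=
  ⟨e.target ∩ e.symm ⁻¹' U, e.isOpen_inter_preimage_symm hU⟩

namespace NullFrameOn

variable {g : LorentzMetric M} {U : Set M} (F : NullFrameOn g U)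

theorem isFrameOn (hU : IsOpen U) {e : OpenPartialHomeomorph M E4} (he : e ∈ atlas E4 M) :
    IsFrameOn (coordDomain hU e) (g.inChart e) (vecInChart F.l e) (vecInChart F.n e)
      (vecInChart (F.m 0) e) (vecInChart (F.m 1) e) where
  smooth_G a b := (g.contDiffOn_inChart he a b).mono Set.inter_subset_left
  smooth_l := contDiffOn_vecInChart F.smooth_l he
  smooth_n := contDiffOn_vecInChart F.smooth_n he
  smooth_p := contDiffOn_vecInChart (F.smooth_m 0) he
  smooth_q := contDiffOn_vecInChart (F.smooth_m 1) he
  G_symm _ _ _ _ := g.symm _ _ _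
  ll y hy := (g.inner_eq _ _ he hy.1).trans (F.l_l _ hy.2)
  nn y hy := (g.inner_eq _ _ he hy.1).trans (F.n_n _ hy.2)
  ln y hy := (g.inner_eq _ _ he hy.1).trans (F.l_n _ hy.2)
  lp y hy := (g.inner_eq _ _ he hy.1).trans (F.l_m 0 _ hy.2)
  lq y hy := (g.inner_eq _ _ he hy.1).trans (F.l_m 1 _ hy.2)
  np y hy := (g.inner_eq _ _ he hy.1).trans (F.n_m 0 _ hy.2)
  nq y hy := (g.inner_eq _ _ he hy.1).trans (F.n_m 1 _ hy.2)
  pp y hy := (g.inner_eq _ _ he hy.1).trans ((F.m_m 0 0 _ hy.2).trans (by simp))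
  pq y hy := (g.inner_eq _ _ he hy.1).trans ((F.m_m 0 1 _ hy.2).trans (by simp))
  qq y hy := (g.inner_eq _ _ he hy.1).trans ((F.m_m 1 1 _ hy.2).trans (by simp))

theorem exists_isSolution (hU : IsOpen U) {γ' α' β' Λ : ℝ}
    (hvac : IsVacuumSolutionOn g U γ' α' β' Λ) (hRicci : F.IsRicciTypeIII Λ)
    (hWeyl : F.IsAlignedPetrovII) {e : OpenPartialHomeomorph M E4} (he : e ∈ atlas E4 M) :
    ∃ ψ χ w : E4 → ℝ, IsFrameOn.IsSolution (coordDomain hU e) (g.inChart e) (vecInChart F.l e)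
      (vecInChart F.n e) (vecInChart (F.m 0) e) (vecInChart (F.m 1) e) γ' α' β' Λ ψ χ w := by
  obtain ⟨ψ, w, hψ, hR⟩ := hRicci
  refine ⟨fun y => ψ 0 (e.symm y), fun y => ψ 1 (e.symm y), fun y => w (e.symm y), ?_, ?_, ?_, ?_⟩
  · exact fun y hy => hvac e he y hy.1 hy.2
  · intro y hy a b
    have h := hR e he y hy.1 hy.2 a b
    rw [Fin.sum_univ_two] at h
    exact h
  · intro y hy
    have h := hψ _ hy.2
    rwa [Fin.sum_univ_two] at h
  · intro A B C D hABCD y hy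
    have h := hWeyl A B C D hABCD e he y hy.1 hy.2
    have hv : ∀ A, vecInChart (F.vec A) e = (![vecInChart F.l e, vecInChart F.n e,
        vecInChart (F.m 0) e, vecInChart (F.m 1) e] : Fin 4 → _) A := fun A => by
      fin_cases A <;> rfl
    simpa only [weylComponent, hv] using h

theorem isKundt_of_opticalMatrix_eq_zero (hg : F.IsGeodetic)
    (h : ForAllCoords U fun e y => F.opticalMatrix e y = 0) : F.IsKundt where
  geodetic := hg
  nonexpanding e he y hy hyU := by simp [expansion, h e he y hy hyU]
  shearfree e he y hy hyU := by simp [shearMatrix, expansion, h e he y hy hyU]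
  twistfree e he y hy hyU := by simp [twistMatrix, h e he y hy hyU]

end NullFrameOn

end QuadraticGravity

end

open QuadraticGravity in
theorem proposition2 {M : Type*} [TopologicalSpace M] [ChartedSpace E4 M]
    [IsManifold (𝓡 4) ∞ M] (g : LorentzMetric M) (U : Set M) (hU : IsOpen U)
    (F : NullFrameOn g U) (γ' α' β' Λ : ℝ)
    (hparam : α' ≠ 0 ∨ γ' + 8 * β' * Λ ≠ 0)
    (hvac : IsVacuumSolutionOn g U γ' α' β' Λ)
    (hRicci : F.IsRicciTypeIII Λ)
    (hWeyl : F.IsAlignedPetrovII) :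
    F.IsGeodetic ∧ F.IsKundt := by
  have hg : F.IsGeodetic := fun e he y hy hyU => by
    obtain ⟨ψ, χ, w, hs⟩ := F.exists_isSolution hU hvac hRicci hWeyl he
    exact (F.isFrameOn hU he).geodetic hs ⟨hy, hyU⟩
  refine ⟨hg, F.isKundt_of_opticalMatrix_eq_zero hg fun e he y hy hyU => ?_⟩
  obtain ⟨ψ, χ, w, hs⟩ := F.exists_isSolution hU hvac hRicci hWeyl he
  ext i j
  have h := (F.isFrameOn hU he).optical hs hparam ⟨hy, hyU⟩ i j
  have hm : ∀ i, vecInChart (F.m i) e = (![vecInChart (F.m 0) e, vecInChart (F.m 1) e] :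
      Fin 2 → _) i := fun i => by fin_cases i <;> rfl
  rwa [← hm i, ← hm j] at h
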